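/- **Theorem 1.3.** Let $n\ge 5$ be an integer, $-2<\alpha<n-4$, $p>1$, and let $\beta\in\mathbb R$ be such that $$\frac{n+\alpha}{2}+\frac{n+\beta}{p+1}=n-2 .$$ Let $\mu>0$ and $\lambda\le (n-2)(\alpha+2)-2\sqrt\mu$, and put $$K_2=\frac{(n-2)^2+(\alpha+2)^2}{2}-\lambda,\qquad K_0=\frac{(n-4-\alpha)^2(n+\alpha)^2}{16}-\lambda\Big(\frac{n-4-\alpha}{2}\Big)^2+\mu .$$ (i) Let $u\in C^4(\mathbb R^n\setminus\{0\})$ be a positive radial solution of $$\Delta(|x|^{-\alpha}\Delta u)+\lambda\,\mathrm{div}(|x|^{-\alpha-2}\nabla u)+\mu|x|^{-\alpha-4}u=|x|^\beta u^p\quad\text{in }\mathbb R^n\setminus\{0\}$$ whose singularity at the origin is non-removable, that is, $u$ has no continuous extension to $\mathbb R^n$. Then the function $v:\mathbb R\to\mathbb R$ given by $v(t)=|x|^{\frac{n-4-\alpha}{2}}u(x)$ for $t=-\ln|x|$ is periodic (it has some period $T>0$; constant functions count as periodic). (ii) For every $a\in(0,K_0^{1/(p-1)})$ there is a periodic solution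 $v\in C^4(\mathbb R)$ of $$v^{(4)}-K_2v''+K_0v=v^p\quad\text{in }\mathbb R$$ with minimum value $a$, and it is unique up to translations: every periodic $C^4$ solution $w$ with minimum value $a$ is of the form $w(t)=v(t+\tau)$ for some $\tau\in\mathbb R$. -/

import Mathlib

open Filter Topology

/-- The divergence of a vector field `F` on `ℝⁿ`, the trace of its derivative. -/
noncomputable def divergence {n : ℕ}
    (F : EuclideanSpace ℝ (Fin n) → EuclideanSpace ℝ (Fin n)) (x : EuclideanSpace ℝ (Fin n)) : ℝ :=
  ∑ i, fderiv ℝ F x (EuclideanSpace.single i 1) i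

/-- `u` is a positive radial `C⁴` solution on `ℝⁿ \ {0}` of
`Δ(|x|^{-α} Δu) + lam div(|x|^{-α-2} ∇u) + μ |x|^{-α-4} u = |x|^β u^p`.
All conditions concern `x ≠ 0` only; the value `u 0` plays no role. -/
structure IsPositiveRadialSolution {n : ℕ} (α β p lam μ : ℝ)
    (u : EuclideanSpace ℝ (Fin n) → ℝ) : Prop where
  contDiffOn : ContDiffOn ℝ 4 u {0}ᶜ
  pos : ∀ x, x ≠ 0 → 0 < u x
  radial : ∀ x y, ‖x‖ = ‖y‖ → u x = u y
  equation : ∀ x, x ≠ 0 →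
    Laplacian.laplacian (fun y => ‖y‖ ^ (-α) * Laplacian.laplacian u y) x
      + lam * divergence (fun y => ‖y‖ ^ (-α - 2) • gradient u y) x
      + μ * ‖x‖ ^ (-α - 4) * u x
    = ‖x‖ ^ β * u x ^ p

/-- The origin is a removable singularity of `u`: `u` restricted to `ℝⁿ \ {0}` extends
continuously to the origin. -/
def HasRemovableSingularity {n : ℕ} (u : EuclideanSpace ℝ (Fin n) → ℝ) : Prop :=
  ∃ c : ℝ, Tendsto u (𝓝[≠] 0) (𝓝 c)

/-- `v` is the Emden–Fowler transform of `u`: `v t = |x|^{(n-4-α)/2} u x` where `t = -ln |x|`.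
As `x` runs over `ℝⁿ \ {0}` the number `-ln |x|` takes every real value, so at most one `v`
has this property. -/
def IsEmdenFowlerTransform {n : ℕ} (α : ℝ) (u : EuclideanSpace ℝ (Fin n) → ℝ) (v : ℝ → ℝ) : Prop :=
  ∀ x, x ≠ 0 → v (-Real.log ‖x‖) = ‖x‖ ^ (((n : ℝ) - 4 - α) / 2) * u x

/-- The coefficient `K₂` of the Emden–Fowler equation. -/
noncomputable def coeffK2 (n : ℕ) (α lam : ℝ) : ℝ :=
  (((n : ℝ) - 2) ^ 2 + (α + 2) ^ 2) / 2 - lam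

/-- The coefficient `K₀` of the Emden–Fowler equation. -/
noncomputable def coeffK0 (n : ℕ) (α lam μ : ℝ) : ℝ :=
  ((n : ℝ) - 4 - α) ^ 2 * ((n : ℝ) + α) ^ 2 / 16 - lam * (((n : ℝ) - 4 - α) / 2) ^ 2 + μ

/-- `v` is a `C⁴` solution on `ℝ` of `v⁗ - K₂ v″ + K₀ v = v^p`. -/
def IsODESolution (K2 K0 p : ℝ) (v : ℝ → ℝ) : Prop :=
  ContDiff ℝ 4 v ∧
    ∀ t, iteratedDeriv 4 v t - K2 * iteratedDeriv 2 v t + K0 * v t = v t ^ p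

/-- `v` has some period `T > 0` (constant functions are periodic). -/
def IsPeriodic (v : ℝ → ℝ) : Prop :=
  ∃ T : ℝ, 0 < T ∧ Function.Periodic v T

open Set

/-! ### Scalar differential inequalities -/

/-! In the variable `t = -ln |x|` the equation is autonomous, and the bound on `lam` together with
`μ > 0` factors it as `(D² - A)(D² - B) v = v^p` with `γ² < A ≤ B`, where `γ = (n-4-α)/2`
(`exists_coeff_factorization`).

Since `A, B ≥ 0` and the power, suitably truncated, is nondecreasing and Lipschitz, the system for
`(v, v', y, y')` with `y = v'' - B v` is cooperative: ordered states stay ordered and their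
differences never drop below the initial ones. Two bounded nonnegative solutions sharing `v` and
`v'` at one point therefore coincide, since otherwise, after a time reversal if needed, one would
run away from the other to infinity (`IsTrajectory.eq_of_bounded`). Applied to a solution and its
mirror image, this gives symmetry about every critical point, and two critical points give a period.

A bounded positive solution that is not periodic thus has at most one critical point and converges.
The function `r = y - A v` is bounded and `r'' = v^p - A B v`. This leaves only `0` and the
equilibrium `m = (A B)^(1/(p-1))` as limits, and a solution on one side of `m` must be constant. So
the limit is `0`, the decay beats `e^{-γ t}`, and `u` tends to `0` at the origin: the singularity is
removable. Boundedness itself comes from a Harnack estimate and superlinearity, once `y ≤ 0` is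
known; `y > 0` somewhere would cause blow-up in finite time (`IsTrajectory.y_nonpos_of_rpow`).

Existence is by shooting in `η = y(0)` among even trajectories with `v(0) = a < m`. If every one
left the region `v > 0 > y`, the sets of `η` exiting through each face would be open, nonempty and
disjoint and would cover the line (`exists_positive_isTrajectory`). Uniqueness is again
`IsTrajectory.eq_of_bounded`, at the minimum point. -/

lemma HasDerivAt.comp_reflect {f : ℝ → ℝ} {f' x : ℝ} (h : HasDerivAt f f' (-x)) :
    HasDerivAt (fun s => f (-s)) (-f') x := by
  simpa [Function.comp_def] using h.comp x (hasDerivAt_neg x)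

lemma monotoneOn_Icc_of_hasDerivAt {f f' : ℝ → ℝ} {a b : ℝ}
    (h : ∀ t ∈ Icc a b, HasDerivAt f (f' t) t) (h' : ∀ t ∈ Icc a b, 0 ≤ f' t) :
    MonotoneOn f (Icc a b) := by
  refine monotoneOn_of_hasDerivWithinAt_nonneg (f' := f') (convex_Icc a b)
    (fun t ht => (h t ht).continuousAt.continuousWithinAt) ?_ ?_
  · intro t ht
    exact (h t (interior_subset ht)).hasDerivWithinAt
  · intro t ht
    exact h' t (interior_subset ht)

lemma le_of_hasDerivAt_nonneg {f f' : ℝ → ℝ} {a b : ℝ} (hab : a ≤ b)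
    (h : ∀ t ∈ Icc a b, HasDerivAt f (f' t) t) (h' : ∀ t ∈ Icc a b, 0 ≤ f' t) : f a ≤ f b :=
  monotoneOn_Icc_of_hasDerivAt h h' (left_mem_Icc.2 hab) (right_mem_Icc.2 hab) hab

lemma add_mul_le_of_le_hasDerivAt {f f' : ℝ → ℝ} {a b c : ℝ} (hab : a ≤ b)
    (h : ∀ t ∈ Icc a b, HasDerivAt f (f' t) t) (h' : ∀ t ∈ Icc a b, c ≤ f' t) :
    f a + c * (b - a) ≤ f b := by
  have := le_of_hasDerivAt_nonneg (f := fun t => f t - c * t) (f' := fun t => f' t - c * 1) hab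
    (fun t ht => (h t ht).fun_sub ((hasDerivAt_id t).const_mul c))
    (fun t ht => by linarith [h' t ht])
  beta_reduce at this
  linarith

lemma le_add_mul_of_hasDerivAt_le {f f' : ℝ → ℝ} {a b c : ℝ} (hab : a ≤ b)
    (h : ∀ t ∈ Icc a b, HasDerivAt f (f' t) t) (h' : ∀ t ∈ Icc a b, f' t ≤ c) :
    f b ≤ f a + c * (b - a) := by
  have := add_mul_le_of_le_hasDerivAt (f := fun t => -f t) (c := -c) hab
    (fun t ht => (h t ht).fun_neg) (fun t ht => by linarith [h' t ht])
  beta_reduce at this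
  linarith

/-- If `y'' ≥ A y` with `A ≥ 0` and `y`, `y'` are nonnegative at the left end of an interval, then
both are bounded below by their values there. -/
lemma le_of_mul_le_deriv_deriv {A t₀ T : ℝ} (hA : 0 ≤ A) {y q g : ℝ → ℝ}
    (hy : ∀ t ∈ Icc t₀ T, HasDerivAt y (q t) t) (hq : ∀ t ∈ Icc t₀ T, HasDerivAt q (g t) t)
    (hg : ∀ t ∈ Icc t₀ T, A * y t ≤ g t) (h0 : 0 ≤ y t₀) (h1 : 0 ≤ q t₀) :
    ∀ t ∈ Icc t₀ T, y t₀ ≤ y t ∧ q t₀ ≤ q t := by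
  obtain ⟨a, ha, rfl⟩ : ∃ a, 0 ≤ a ∧ A = a ^ 2 := ⟨√A, Real.sqrt_nonneg _, (Real.sq_sqrt hA).symm⟩
  have hexp : ∀ c t : ℝ, HasDerivAt (fun s => Real.exp (c * s)) (Real.exp (c * t) * c) t :=
    fun c t => by simpa using ((hasDerivAt_id t).const_mul c).exp
  -- With `A = a²` the operator `D² - a²` factors as `(D - a)(D + a)`, and each first order factor
  -- is handled by its integrating factor.
  have hsum : ∀ t ∈ Icc t₀ T, 0 ≤ q t + a * y t := by
    intro t ht
    have hsub : ∀ s ∈ Icc t₀ t, s ∈ Icc t₀ T := fun s hs => ⟨hs.1, hs.2.trans ht.2⟩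
    have := le_of_hasDerivAt_nonneg (f := fun s => Real.exp (-a * s) * (q s + a * y s)) ht.1
      (fun s hs => (hexp (-a) s).fun_mul ((hq s (hsub s hs)).fun_add ((hy s (hsub s hs)).const_mul a)))
      (fun s hs => by
        have h2 := hg s (hsub s hs)
        have h3 := Real.exp_pos (-a * s)
        have : 0 ≤ Real.exp (-a * s) * (g s - a ^ 2 * y s) := by
          apply mul_nonneg h3.le; linarith
        linarith)
    beta_reduce at this
    have h4 : 0 ≤ Real.exp (-a * t₀) * (q t₀ + a * y t₀) := by positivity
    exact nonneg_of_mul_nonneg_right (h4.trans this) (Real.exp_pos _)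
  have hy0 : ∀ t ∈ Icc t₀ T, 0 ≤ y t := by
    intro t ht
    have hsub : ∀ s ∈ Icc t₀ t, s ∈ Icc t₀ T := fun s hs => ⟨hs.1, hs.2.trans ht.2⟩
    have := le_of_hasDerivAt_nonneg (f := fun s => Real.exp (a * s) * y s) ht.1
      (fun s hs => (hexp a s).fun_mul (hy s (hsub s hs)))
      (fun s hs => by
        have : 0 ≤ Real.exp (a * s) * (q s + a * y s) :=
          mul_nonneg (Real.exp_pos _).le (hsum s (hsub s hs))
        linarith)
    beta_reduce at this
    have h4 : 0 ≤ Real.exp (a * t₀) * y t₀ := by positivity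
    exact nonneg_of_mul_nonneg_right (h4.trans this) (Real.exp_pos _)
  have hqt : ∀ t ∈ Icc t₀ T, q t₀ ≤ q t := by
    intro t ht
    refine le_of_hasDerivAt_nonneg ht.1 (fun s hs => hq s ⟨hs.1, hs.2.trans ht.2⟩) ?_
    intro s hs
    have hs' : s ∈ Icc t₀ T := ⟨hs.1, hs.2.trans ht.2⟩
    exact (mul_nonneg (sq_nonneg a) (hy0 s hs')).trans (hg s hs')
  intro t ht
  refine ⟨le_of_hasDerivAt_nonneg ht.1 (fun s hs => hy s ⟨hs.1, hs.2.trans ht.2⟩) ?_, hqt t ht⟩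
  intro s hs
  exact h1.trans (hqt s ⟨hs.1, hs.2.trans ht.2⟩)

lemma exists_lt_of_le_deriv {f f' : ℝ → ℝ} {t₀ c : ℝ} (hc : 0 < c)
    (h : ∀ t, t₀ ≤ t → HasDerivAt f (f' t) t) (h' : ∀ t, t₀ ≤ t → c ≤ f' t) (M : ℝ) :
    ∃ t₁, t₀ ≤ t₁ ∧ ∀ t, t₁ ≤ t → M < f t := by
  refine ⟨max t₀ (t₀ + (M - f t₀ + 1) / c), le_max_left _ _, fun t ht => ?_⟩
  have h1 : t₀ ≤ t := (le_max_left _ _).trans ht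
  have h2 : t₀ + (M - f t₀ + 1) / c ≤ t := (le_max_right _ _).trans ht
  have h3 := add_mul_le_of_le_hasDerivAt h1 (fun s hs => h s hs.1) (fun s hs => h' s hs.1)
  have h4 : (M - f t₀ + 1) / c ≤ t - t₀ := by linarith
  rw [div_le_iff₀ hc] at h4
  linarith

lemma exists_lt_of_le_deriv_deriv {f f' f'' : ℝ → ℝ} {t₀ c : ℝ} (hc : 0 < c)
    (h : ∀ t, t₀ ≤ t → HasDerivAt f (f' t) t) (h' : ∀ t, t₀ ≤ t → HasDerivAt f' (f'' t) t)
    (h'' : ∀ t, t₀ ≤ t → c ≤ f'' t) (M : ℝ) : ∃ t₁, t₀ ≤ t₁ ∧ ∀ t, t₁ ≤ t → M < f t := by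
  obtain ⟨t₁, h1, h2⟩ := exists_lt_of_le_deriv hc h' h'' 1
  obtain ⟨t₂, h3, h4⟩ := exists_lt_of_le_deriv one_pos (fun t ht => h t (h1.trans ht))
    (fun t ht => (h2 t ht).le) M
  exact ⟨t₂, h1.trans h3, h4⟩

/-- A convex function on the line that is bounded above is constant. -/
lemma deriv_eq_zero_of_bddAbove_of_convex {r s g : ℝ → ℝ} {M : ℝ}
    (hr : ∀ t, HasDerivAt r (s t) t) (hs : ∀ t, HasDerivAt s (g t) t) (hg : ∀ t, 0 ≤ g t)
    (hM : ∀ t, r t ≤ M) (t : ℝ) : s t = 0 := by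
  rcases lt_trichotomy (s t) 0 with h | h | h
  · exfalso
    obtain ⟨t₁, -, h2⟩ := exists_lt_of_le_deriv (f := fun x => r (-x)) (f' := fun x => -s (-x))
      (t₀ := -t) (c := -s t) (by linarith)
      (fun x _ => (hr (-x)).comp_reflect)
      (fun x hx => by
        have := le_of_hasDerivAt_nonneg (show -x ≤ t by linarith) (fun u _ => hs u)
          (fun u _ => hg u)
        linarith) M
    have := h2 t₁ le_rfl
    linarith [hM (-t₁)]
  · exact h
  · exfalso
    obtain ⟨t₁, -, h2⟩ := exists_lt_of_le_deriv (f := r) (f' := s) (t₀ := t) h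
      (fun x _ => hr x)
      (fun x hx => le_of_hasDerivAt_nonneg hx (fun u _ => hs u) (fun u _ => hg u)) M
    have := h2 t₁ le_rfl
    linarith [hM t₁]

lemma exists_first_zero {f : ℝ → ℝ} {a b : ℝ} (hab : a ≤ b) (hf : ContinuousOn f (Icc a b))
    (ha : 0 < f a) (hb : f b ≤ 0) : ∃ s ∈ Ioc a b, f s = 0 ∧ ∀ t ∈ Ico a s, 0 < f t := by
  have hcl : IsClosed (Icc a b ∩ f ⁻¹' Iic 0) := hf.preimage_isClosed_of_isClosed isClosed_Icc
    isClosed_Iic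
  have hcp : IsCompact (Icc a b ∩ f ⁻¹' Iic 0) := isCompact_Icc.of_isClosed_subset hcl
    inter_subset_left
  obtain ⟨s, ⟨⟨hs1, hs2⟩, hs3⟩, hs4⟩ := hcp.exists_isLeast ⟨b, right_mem_Icc.2 hab, hb⟩
  have hpos : ∀ t ∈ Ico a s, 0 < f t := by
    intro t ht
    by_contra hcon
    exact absurd (hs4 ⟨⟨ht.1, ht.2.le.trans hs2⟩, not_lt.1 hcon⟩) (not_le.2 ht.2)
  have has : a < s := by
    rcases hs1.eq_or_lt with h | h
    · subst h
      exact absurd ha (not_lt.2 hs3)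
    · exact h
  refine ⟨s, ⟨has, hs2⟩, le_antisymm hs3 ?_, hpos⟩
  have h1 : Tendsto f (𝓝[Ico a s] s) (𝓝 (f s)) :=
    (hf s ⟨hs1, hs2⟩).mono (fun t ht => ⟨ht.1, ht.2.le.trans hs2⟩)
  have : (𝓝[Ico a s] s).NeBot := by
    rw [← mem_closure_iff_nhdsWithin_neBot, closure_Ico has.ne]
    exact right_mem_Icc.2 has.le
  exact ge_of_tendsto h1 (eventually_nhdsWithin_of_forall fun t ht => (hpos t ht).le)

/-- Cone invariance for the cooperative system `z'' = B z + y`, `y'' = A y + φ`. -/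
lemma le_of_cooperative {A B K t₀ : ℝ} (hA : 0 ≤ A) (hB : 0 ≤ B) (hK : 0 ≤ K)
    {z w y q φ : ℝ → ℝ}
    (hz : ∀ t, t₀ ≤ t → HasDerivAt z (w t) t)
    (hw : ∀ t, t₀ ≤ t → HasDerivAt w (B * z t + y t) t)
    (hy : ∀ t, t₀ ≤ t → HasDerivAt y (q t) t)
    (hq : ∀ t, t₀ ≤ t → HasDerivAt q (A * y t + φ t) t)
    (hφ : ∀ t, t₀ ≤ t → K * min (z t) 0 ≤ φ t)
    (hz0 : 0 ≤ z t₀) (hw0 : 0 ≤ w t₀) (hy0 : 0 ≤ y t₀) (hq0 : 0 ≤ q t₀) :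
    ∀ t, t₀ ≤ t → z t₀ ≤ z t ∧ w t₀ ≤ w t ∧ y t₀ ≤ y t ∧ q t₀ ≤ q t := by
  -- `κ` is so large that `(κ² - B)(κ² - A) ≥ K`: adding `ε e^{κ(t - t₀)}` to `z` and `ε (κ² - B)
  -- e^{κ(t - t₀)}` to `y` preserves the equation for `z''` and absorbs the possibly negative part
  -- of `φ`.
  set κ : ℝ := A + B + K + 1 with hκ
  have hκ1 : 1 ≤ κ := by linarith
  have hκB : 1 ≤ κ ^ 2 - B := by nlinarith
  have hκA : K ≤ κ ^ 2 - A := by nlinarith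
  have hκK : K ≤ (κ ^ 2 - B) * (κ ^ 2 - A) := by nlinarith
  have hE : ∀ t, HasDerivAt (fun s => Real.exp (κ * (s - t₀))) (κ * Real.exp (κ * (t - t₀))) t :=
    fun t => by
      have := (((hasDerivAt_id t).sub_const t₀).const_mul κ).exp
      simp only [id, mul_one] at this
      rwa [mul_comm] at this
  have hpert : ∀ ε > 0, ∀ t, t₀ ≤ t → 0 < z t + ε * Real.exp (κ * (t - t₀)) := by
    intro ε hε t ht
    by_contra hcon
    have hzε : ∀ s, t₀ ≤ s → HasDerivAt (fun s => z s + ε * Real.exp (κ * (s - t₀)))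
        (w s + ε * (κ * Real.exp (κ * (s - t₀)))) s :=
      fun s hs => (hz s hs).fun_add ((hE s).const_mul ε)
    -- Up to its first zero `s` the perturbed `z` is nonnegative, so the perturbed `y` and then the
    -- perturbed `z` stay above their initial values; the latter is at least `ε`, which excludes a
    -- zero at `s`.
    obtain ⟨s, hs, hs0, hspos⟩ := exists_first_zero
      (f := fun s => z s + ε * Real.exp (κ * (s - t₀))) ht
      (fun s hs => (hzε s hs.1).continuousAt.continuousWithinAt)
      (by simp only [sub_self, mul_zero, Real.exp_zero, mul_one]; linarith) (not_lt.1 hcon)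
    have hnn : ∀ u ∈ Icc t₀ s, 0 ≤ z u + ε * Real.exp (κ * (u - t₀)) := by
      intro u hu
      rcases hu.2.eq_or_lt with h | h
      · rw [h]; exact hs0.ge
      · exact (hspos u ⟨hu.1, h⟩).le
    have hy1 := le_of_mul_le_deriv_deriv hA (t₀ := t₀) (T := s)
      (y := fun u => y u + ε * (κ ^ 2 - B) * Real.exp (κ * (u - t₀)))
      (fun u hu => (hy u hu.1).fun_add ((hE u).const_mul _))
      (fun u hu => (hq u hu.1).fun_add (((hE u).const_mul κ).const_mul (ε * (κ ^ 2 - B))))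
      (fun u hu => by
        have h1 := hφ u hu.1
        have h2 := hnn u hu
        have h3 := Real.exp_pos (κ * (u - t₀))
        set e := Real.exp (κ * (u - t₀))
        have h5 : -(ε * e) ≤ min (z u) 0 := le_min (by linarith) (by nlinarith)
        have h6 : K * -(ε * e) ≤ K * min (z u) 0 := mul_le_mul_of_nonneg_left h5 hK
        have h7 : K * (ε * e) ≤ (κ ^ 2 - B) * (κ ^ 2 - A) * (ε * e) :=
          mul_le_mul_of_nonneg_right hκK (by positivity)
        linarith)
      (by simp only [sub_self, mul_zero, Real.exp_zero, mul_one]; nlinarith)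
      (by
        simp only [sub_self, mul_zero, Real.exp_zero, mul_one]
        have : 0 ≤ ε * (κ ^ 2 - B) * κ := by
          apply mul_nonneg (mul_nonneg hε.le _) <;> linarith
        linarith)
    have hz1 := le_of_mul_le_deriv_deriv hB (t₀ := t₀) (T := s)
      (y := fun u => z u + ε * Real.exp (κ * (u - t₀)))
      (fun u hu => hzε u hu.1)
      (fun u hu => (hw u hu.1).fun_add (((hE u).const_mul κ).const_mul ε))
      (fun u hu => by
        have h1 := (hy1 u hu).1
        simp only [sub_self, mul_zero, Real.exp_zero, mul_one] at h1
        have h2 : 0 ≤ ε * (κ ^ 2 - B) := mul_nonneg hε.le (by linarith)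
        linarith)
      (by simp only [sub_self, mul_zero, Real.exp_zero, mul_one]; linarith)
      (by simp only [sub_self, mul_zero, Real.exp_zero, mul_one]; nlinarith)
      s (right_mem_Icc.2 hs.1.le)
    have h1 := hz1.1
    simp only [sub_self, mul_zero, Real.exp_zero, mul_one] at h1 hs0
    linarith
  have hznn : ∀ t, t₀ ≤ t → 0 ≤ z t := by
    intro t ht
    refine le_of_forall_pos_lt_add fun δ hδ => ?_
    have h3 := Real.exp_pos (κ * (t - t₀))
    have := hpert (δ / Real.exp (κ * (t - t₀))) (by positivity) t ht
    rwa [div_mul_cancel₀ _ h3.ne'] at this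
  intro t ht
  have h1 := le_of_mul_le_deriv_deriv hA (t₀ := t₀) (T := t) (fun u hu => hy u hu.1)
    (fun u hu => hq u hu.1)
    (fun u hu => by
      have := hφ u hu.1
      rw [min_eq_right (hznn u hu.1)] at this
      linarith) hy0 hq0
  have h2 := le_of_mul_le_deriv_deriv hB (t₀ := t₀) (T := t) (fun u hu => hz u hu.1)
    (fun u hu => hw u hu.1)
    (fun u hu => by linarith [(h1 u hu).1]) hz0 hw0
  have ht' : t ∈ Icc t₀ t := ⟨ht, le_rfl⟩
  exact ⟨(h2 t ht').1, (h2 t ht').2, (h1 t ht').1, (h1 t ht').2⟩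

/-- If `0 ≤ Y` and `Y'' ≤ a² Y` on the whole line, then `|Y'| ≤ a Y`. -/
lemma abs_deriv_le_of_deriv_deriv_le {a : ℝ} (ha : 0 ≤ a) {Y P G : ℝ → ℝ}
    (hY : ∀ t, HasDerivAt Y (P t) t) (hP : ∀ t, HasDerivAt P (G t) t)
    (hG : ∀ t, G t ≤ a ^ 2 * Y t) (h0 : ∀ t, 0 ≤ Y t) (t : ℝ) : |P t| ≤ a * Y t := by
  -- The lower bound suffices, by time reversal. If `P + a Y` equals `-c < 0` at `t`, then, `e^{-a
  -- s}(P + a Y)` being nonincreasing, it stays below `-c` afterwards, and `Y` would become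
  -- negative.
  have key : ∀ {Y P G : ℝ → ℝ}, (∀ t, HasDerivAt Y (P t) t) → (∀ t, HasDerivAt P (G t) t) →
      (∀ t, G t ≤ a ^ 2 * Y t) → (∀ t, 0 ≤ Y t) → ∀ t, -(a * Y t) ≤ P t := by
    intro Y P G hY hP hG h0 t
    by_contra hcon
    set c := -(P t + a * Y t) with hc
    have hcpos : 0 < c := by linarith
    have hexp : ∀ u : ℝ, HasDerivAt (fun s => Real.exp (-a * s)) (Real.exp (-a * u) * -a) u :=
      fun u => by simpa using ((hasDerivAt_id u).const_mul (-a)).exp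
    have h1 : ∀ u, t ≤ u → P u + a * Y u ≤ -c := by
      intro u hu
      have := le_of_hasDerivAt_nonneg (f := fun s => -(Real.exp (-a * s) * (P s + a * Y s))) hu
        (fun s _ => ((hexp s).fun_mul ((hP s).fun_add ((hY s).const_mul a))).fun_neg)
        (fun s _ => by
          have : 0 ≤ Real.exp (-a * s) * (a ^ 2 * Y s - G s) :=
            mul_nonneg (Real.exp_pos _).le (by linarith [hG s])
          linarith)
      beta_reduce at this
      have h2 : Real.exp (-a * u) * (P u + a * Y u) ≤ Real.exp (-a * t) * (-c) := by
        rw [hc]; linarith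
      have h3 : Real.exp (-a * u) ≤ Real.exp (-a * t) := Real.exp_le_exp.2 (by nlinarith)
      have h4 : Real.exp (-a * t) * (-c) ≤ Real.exp (-a * u) * (-c) := by nlinarith
      exact le_of_mul_le_mul_left (h2.trans h4) (Real.exp_pos _)
    obtain ⟨t₁, h2, h3⟩ := exists_lt_of_le_deriv (f := fun s => -Y s) (f' := fun s => -P s) hcpos
      (fun u _ => (hY u).fun_neg)
      (fun u hu => by
        have := h1 u hu
        have := mul_nonneg ha (h0 u)
        linarith) 0
    have := h3 t₁ le_rfl
    linarith [h0 t₁]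
  rw [abs_le]
  refine ⟨key hY hP hG h0 t, ?_⟩
  have := key (Y := fun s => Y (-s)) (P := fun s => -P (-s)) (G := fun s => G (-s))
    (fun s => (hY (-s)).comp_reflect)
    (fun s => by simpa using (hP (-s)).comp_reflect.fun_neg)
    (fun s => hG (-s)) (fun s => h0 (-s)) (-t)
  simp only [neg_neg] at this
  linarith

/-- Harnack inequality derived from a logarithmic gradient bound. -/
lemma exp_mul_le_of_abs_deriv_le {a : ℝ} {Y P : ℝ → ℝ} (hY : ∀ t, HasDerivAt Y (P t) t)
    (hP : ∀ t, |P t| ≤ a * Y t) {s t : ℝ} (hst : s ≤ t) :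
    Real.exp (-a * (t - s)) * Y s ≤ Y t ∧ Y t ≤ Real.exp (a * (t - s)) * Y s := by
  have hexp : ∀ c u : ℝ, HasDerivAt (fun x => Real.exp (c * (x - s)))
      (Real.exp (c * (u - s)) * c) u :=
    fun c u => by simpa using (((hasDerivAt_id u).sub_const s).const_mul c).exp
  constructor
  · have := le_of_hasDerivAt_nonneg (f := fun x => Real.exp (a * (x - s)) * Y x) hst
      (fun x _ => (hexp a x).fun_mul (hY x))
      (fun x _ => by
        have : 0 ≤ Real.exp (a * (x - s)) * (P x + a * Y x) :=
          mul_nonneg (Real.exp_pos _).le (by linarith [(abs_le.1 (hP x)).1])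
        linarith)
    simp only [sub_self, mul_zero, Real.exp_zero, one_mul] at this
    calc Real.exp (-a * (t - s)) * Y s
        ≤ Real.exp (-a * (t - s)) * (Real.exp (a * (t - s)) * Y t) :=
          mul_le_mul_of_nonneg_left this (Real.exp_pos _).le
      _ = Y t := by rw [← mul_assoc, ← Real.exp_add]; simp
  · have := le_of_hasDerivAt_nonneg (f := fun x => -(Real.exp (-a * (x - s)) * Y x)) hst
      (fun x _ => ((hexp (-a) x).fun_mul (hY x)).fun_neg)
      (fun x _ => by
        have : 0 ≤ Real.exp (-a * (x - s)) * (a * Y x - P x) :=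
          mul_nonneg (Real.exp_pos _).le (by linarith [(abs_le.1 (hP x)).2])
        linarith)
    simp only [sub_self, mul_zero, Real.exp_zero, one_mul] at this
    calc Y t = Real.exp (a * (t - s)) * (Real.exp (-a * (t - s)) * Y t) := by
          rw [← mul_assoc, ← Real.exp_add]; simp
      _ ≤ Real.exp (a * (t - s)) * Y s :=
          mul_le_mul_of_nonneg_left (by linarith) (Real.exp_pos _).le

/-! ### Trajectories of `(D² - A)(D² - B) v = f(v)` -/

/-- The functions `v`, `w = v'`, `y = v'' - B v`, `q = y'` solve the first order system equivalent
to `(D² - A)(D² - B) v = f(v)`. -/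
structure IsTrajectory (A B : ℝ) (f v w y q : ℝ → ℝ) : Prop where
  hasDerivAt_v : ∀ t, HasDerivAt v (w t) t
  hasDerivAt_w : ∀ t, HasDerivAt w (B * v t + y t) t
  hasDerivAt_y : ∀ t, HasDerivAt y (q t) t
  hasDerivAt_q : ∀ t, HasDerivAt q (A * y t + f (v t)) t

namespace IsTrajectory

variable {A B M m t₀ : ℝ} {K : NNReal} {f v w y q v₁ w₁ y₁ q₁ v₂ w₂ y₂ q₂ : ℝ → ℝ}

/-- Only even derivatives occur in the equation, so time reversal preserves it; it flips the signs
of `w` and `q`. -/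
lemma reflect (h : IsTrajectory A B f v w y q) (c : ℝ) :
    IsTrajectory A B f (fun t => v (c - t)) (fun t => -w (c - t)) (fun t => y (c - t))
      (fun t => -q (c - t)) where
  hasDerivAt_v t := (h.hasDerivAt_v (c - t)).comp_const_sub c t
  hasDerivAt_w t := by simpa using ((h.hasDerivAt_w (c - t)).comp_const_sub c t).fun_neg
  hasDerivAt_y t := (h.hasDerivAt_y (c - t)).comp_const_sub c t
  hasDerivAt_q t := by simpa using ((h.hasDerivAt_q (c - t)).comp_const_sub c t).fun_neg

lemma shift (h : IsTrajectory A B f v w y q) (c : ℝ) :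
    IsTrajectory A B f (fun t => v (t + c)) (fun t => w (t + c)) (fun t => y (t + c))
      (fun t => q (t + c)) where
  hasDerivAt_v t := (h.hasDerivAt_v (t + c)).comp_add_const t c
  hasDerivAt_w t := (h.hasDerivAt_w (t + c)).comp_add_const t c
  hasDerivAt_y t := (h.hasDerivAt_y (t + c)).comp_add_const t c
  hasDerivAt_q t := (h.hasDerivAt_q (t + c)).comp_add_const t c

lemma continuous_v (h : IsTrajectory A B f v w y q) : Continuous v :=
  continuous_iff_continuousAt.2 fun t => (h.hasDerivAt_v t).continuousAt

lemma continuous_w (h : IsTrajectory A B f v w y q) : Continuous w :=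
  continuous_iff_continuousAt.2 fun t => (h.hasDerivAt_w t).continuousAt

lemma continuous_y (h : IsTrajectory A B f v w y q) : Continuous y :=
  continuous_iff_continuousAt.2 fun t => (h.hasDerivAt_y t).continuousAt

/-- Order preservation: if the state of one trajectory dominates that of another, then the
componentwise differences never drop below their initial values. -/
lemma sub_le_sub (hA : 0 ≤ A) (hB : 0 ≤ B) (hf : Monotone f) (hK : LipschitzWith K f)
    (h₁ : IsTrajectory A B f v₁ w₁ y₁ q₁) (h₂ : IsTrajectory A B f v₂ w₂ y₂ q₂)
    (hv : v₂ t₀ ≤ v₁ t₀) (hw : w₂ t₀ ≤ w₁ t₀) (hy : y₂ t₀ ≤ y₁ t₀) (hq : q₂ t₀ ≤ q₁ t₀)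
    (t : ℝ) (ht : t₀ ≤ t) :
    v₁ t₀ - v₂ t₀ ≤ v₁ t - v₂ t ∧ w₁ t₀ - w₂ t₀ ≤ w₁ t - w₂ t ∧
      y₁ t₀ - y₂ t₀ ≤ y₁ t - y₂ t ∧ q₁ t₀ - q₂ t₀ ≤ q₁ t - q₂ t := by
  refine le_of_cooperative hA hB K.2 (z := fun t => v₁ t - v₂ t) (w := fun t => w₁ t - w₂ t)
    (y := fun t => y₁ t - y₂ t) (q := fun t => q₁ t - q₂ t) (φ := fun t => f (v₁ t) - f (v₂ t))
    (fun t _ => (h₁.hasDerivAt_v t).sub (h₂.hasDerivAt_v t)) (fun t _ => ?_)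
    (fun t _ => (h₁.hasDerivAt_y t).sub (h₂.hasDerivAt_y t)) (fun t _ => ?_) (fun t _ => ?_)
    (by linarith) (by linarith) (by linarith) (by linarith) t ht
  · exact ((h₁.hasDerivAt_w t).sub (h₂.hasDerivAt_w t)).congr_deriv (by ring)
  · exact ((h₁.hasDerivAt_q t).sub (h₂.hasDerivAt_q t)).congr_deriv (by ring)
  -- Monotonicity of `f` gives the sign of the source difference when `v₂ ≤ v₁`; in the other case
  -- the Lipschitz constant bounds its negative part.
  · rcases le_total (v₂ t) (v₁ t) with h | h
    · rw [min_eq_right (by linarith)]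
      linarith [hf h]
    · rw [min_eq_left (by linarith)]
      have h1 := hK.dist_le_mul (v₁ t) (v₂ t)
      rw [Real.dist_eq, Real.dist_eq, abs_of_nonpos (by linarith : v₁ t - v₂ t ≤ 0)] at h1
      change (K : ℝ) * _ ≤ _
      have := neg_abs_le (f (v₁ t) - f (v₂ t))
      linarith

/-- Since `y'' ≥ A y`, both `y` and `q` stay above their initial values; then `v'' = B v + y` is
bounded below by a positive constant, which drives `v'` and `v` to infinity. -/
lemma unbounded_of_pos (hA : 0 ≤ A) (hB : 0 ≤ B) (h : IsTrajectory A B f v w y q)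
    (hv : ∀ t, t₀ ≤ t → 0 ≤ v t) (hf : ∀ t, t₀ ≤ t → 0 ≤ f (v t)) (hy : 0 < y t₀)
    (hq : 0 ≤ q t₀) :
    (∀ t, t₀ ≤ t → y t₀ ≤ y t ∧ q t₀ ≤ q t) ∧
      ∀ M, ∃ t₁, t₀ ≤ t₁ ∧ ∀ t, t₁ ≤ t → M < w t ∧ M < v t := by
  have h1 : ∀ t, t₀ ≤ t → y t₀ ≤ y t ∧ q t₀ ≤ q t := fun t ht =>
    le_of_mul_le_deriv_deriv hA (t₀ := t₀) (T := t) (fun s _ => h.hasDerivAt_y s)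
      (fun s _ => h.hasDerivAt_q s) (fun s hs => by linarith [hf s hs.1]) hy.le hq t ⟨ht, le_rfl⟩
  have h2 : ∀ t, t₀ ≤ t → y t₀ ≤ B * v t + y t := fun t ht => by
    linarith [mul_nonneg hB (hv t ht), (h1 t ht).1]
  refine ⟨h1, fun M => ?_⟩
  obtain ⟨t₁, ht₁, h3⟩ := exists_lt_of_le_deriv hy (fun t _ => h.hasDerivAt_w t) h2 M
  obtain ⟨t₂, ht₂, h4⟩ := exists_lt_of_le_deriv_deriv hy (fun t _ => h.hasDerivAt_v t)
    (fun t _ => h.hasDerivAt_w t) h2 M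
  exact ⟨max t₁ t₂, ht₁.trans (le_max_left _ _), fun t ht =>
    ⟨h3 t ((le_max_left _ _).trans ht), h4 t ((le_max_right _ _).trans ht)⟩⟩

/-- Any gap in `y` or `q` is preserved by the order, so it forces the second derivative of `v₁ - v₂`
to stay above a positive constant, against the boundedness of `v₁ - v₂`. -/
lemma eq_of_bounded_of_le (hA : 0 ≤ A) (hB : 0 ≤ B) (hf : Monotone f) (hK : LipschitzWith K f)
    (h₁ : IsTrajectory A B f v₁ w₁ y₁ q₁) (h₂ : IsTrajectory A B f v₂ w₂ y₂ q₂)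
    (hM : ∀ t, v₁ t ≤ M) (h0 : ∀ t, 0 ≤ v₂ t)
    (hv : v₁ t₀ = v₂ t₀) (hw : w₁ t₀ = w₂ t₀) (hy : y₂ t₀ ≤ y₁ t₀) (hq : q₂ t₀ ≤ q₁ t₀) :
    y₁ t₀ = y₂ t₀ ∧ q₁ t₀ = q₂ t₀ := by
  by_contra hcon
  have hord := sub_le_sub hA hB hf hK h₁ h₂ hv.ge hw.ge hy hq
  set c := (y₁ t₀ - y₂ t₀) + (q₁ t₀ - q₂ t₀) with hc
  have hcpos : 0 < c := by
    rcases hy.lt_or_eq with h | h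
    · linarith
    · rcases hq.lt_or_eq with h' | h'
      · linarith
      · exact absurd ⟨h.symm, h'.symm⟩ hcon
  -- One unit of time turns a gap in `q` into a gap in `y`, so that both cases are treated at once.
  have hy1 : c ≤ y₁ (t₀ + 1) - y₂ (t₀ + 1) := by
    have := add_mul_le_of_le_hasDerivAt (f := fun t => y₁ t - y₂ t) (c := q₁ t₀ - q₂ t₀)
      (show t₀ ≤ t₀ + 1 by linarith)
      (fun t _ => (h₁.hasDerivAt_y t).sub (h₂.hasDerivAt_y t))
      (fun t ht => (hord t ht.1).2.2.2)
    beta_reduce at this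
    linarith
  have hord1 := hord (t₀ + 1) (by linarith)
  have hord2 := sub_le_sub hA hB hf hK h₁ h₂ (t₀ := t₀ + 1) (by linarith) (by linarith)
    (by linarith) (by linarith)
  obtain ⟨t₁, -, h3⟩ := exists_lt_of_le_deriv_deriv (f := fun t => v₁ t - v₂ t) hcpos
    (t₀ := t₀ + 1)
    (fun t _ => (h₁.hasDerivAt_v t).sub (h₂.hasDerivAt_v t))
    (fun t _ => (h₁.hasDerivAt_w t).sub (h₂.hasDerivAt_w t))
    (fun t ht => by
      obtain ⟨a1, -, a3, -⟩ := hord2 t ht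
      have := mul_nonneg hB (show 0 ≤ v₁ t - v₂ t by linarith)
      linarith) M
  have := h3 t₁ le_rfl
  linarith [hM t₁, h0 t₁]

lemma eq_of_state_eq (hA : 0 ≤ A) (hB : 0 ≤ B) (hf : Monotone f) (hK : LipschitzWith K f)
    (h₁ : IsTrajectory A B f v₁ w₁ y₁ q₁) (h₂ : IsTrajectory A B f v₂ w₂ y₂ q₂)
    (hv : v₁ t₀ = v₂ t₀) (hw : w₁ t₀ = w₂ t₀) (hy : y₁ t₀ = y₂ t₀) (hq : q₁ t₀ = q₂ t₀) (t : ℝ) :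
    v₁ t = v₂ t ∧ w₁ t = w₂ t ∧ y₁ t = y₂ t ∧ q₁ t = q₂ t := by
  rcases le_total t₀ t with ht | ht
  · obtain ⟨a1, a2, a3, a4⟩ := sub_le_sub hA hB hf hK h₁ h₂ hv.ge hw.ge hy.ge hq.ge t ht
    obtain ⟨b1, b2, b3, b4⟩ := sub_le_sub hA hB hf hK h₂ h₁ hv.le hw.le hy.le hq.le t ht
    refine ⟨?_, ?_, ?_, ?_⟩ <;> linarith
  · have r₁ := h₁.reflect (2 * t₀)
    have r₂ := h₂.reflect (2 * t₀)
    have e : 2 * t₀ - t₀ = t₀ := by ring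
    have ht' : t₀ ≤ 2 * t₀ - t := by linarith
    obtain ⟨a1, a2, a3, a4⟩ := sub_le_sub hA hB hf hK r₁ r₂ (t₀ := t₀) (by simp [e, hv])
      (by simp [e, hw]) (by simp [e, hy]) (by simp [e, hq]) _ ht'
    obtain ⟨b1, b2, b3, b4⟩ := sub_le_sub hA hB hf hK r₂ r₁ (t₀ := t₀) (by simp [e, hv])
      (by simp [e, hw]) (by simp [e, hy]) (by simp [e, hq]) _ ht'
    simp only [e, sub_sub_cancel, hv, hw, hy, hq, sub_self] at a1 a2 a3 a4 b1 b2 b3 b4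
    refine ⟨?_, ?_, ?_, ?_⟩ <;> linarith

/-- A bounded nonnegative trajectory is determined by the values of `v` and `v'` at one point. -/
lemma eq_of_bounded (hA : 0 ≤ A) (hB : 0 ≤ B) (hf : Monotone f) (hK : LipschitzWith K f)
    (h₁ : IsTrajectory A B f v₁ w₁ y₁ q₁) (h₂ : IsTrajectory A B f v₂ w₂ y₂ q₂)
    (hM₁ : ∀ t, v₁ t ≤ M) (h0₁ : ∀ t, 0 ≤ v₁ t) (hM₂ : ∀ t, v₂ t ≤ M) (h0₂ : ∀ t, 0 ≤ v₂ t)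
    (hv : v₁ t₀ = v₂ t₀) (hw : w₁ t₀ = w₂ t₀) (t : ℝ) :
    v₁ t = v₂ t ∧ w₁ t = w₂ t ∧ y₁ t = y₂ t ∧ q₁ t = q₂ t := by
  have r₁ := h₁.reflect (2 * t₀)
  have r₂ := h₂.reflect (2 * t₀)
  have e : 2 * t₀ - t₀ = t₀ := by ring
  have key : y₁ t₀ = y₂ t₀ ∧ q₁ t₀ = q₂ t₀ := by
    -- When the gaps in `y` and `q` have opposite signs, reflection about `t₀` changes the sign of
    -- the `q` gap and makes the states comparable.
    rcases le_total (y₂ t₀) (y₁ t₀) with hy | hy <;> rcases le_total (q₂ t₀) (q₁ t₀) with hq | hq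
    · exact eq_of_bounded_of_le hA hB hf hK h₁ h₂ hM₁ h0₂ hv hw hy hq
    · have := eq_of_bounded_of_le hA hB hf hK r₁ r₂ (t₀ := t₀) (fun t => hM₁ _) (fun t => h0₂ _)
        (by simp [e, hv]) (by simp [e, hw]) (by simp [e, hy]) (by simp [e, hq])
      simpa [e] using this
    · have := eq_of_bounded_of_le hA hB hf hK r₂ r₁ (t₀ := t₀) (fun t => hM₂ _) (fun t => h0₁ _)
        (by simp [e, hv]) (by simp [e, hw]) (by simp [e, hy]) (by simp [e, hq])
      simpa [e, eq_comm] using this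
    · have := eq_of_bounded_of_le hA hB hf hK h₂ h₁ hM₂ h0₁ hv.symm hw.symm hy hq
      exact ⟨this.1.symm, this.2.symm⟩
  exact eq_of_state_eq hA hB hf hK h₁ h₂ hv hw key.1 key.2 t

/-- A bounded nonnegative trajectory is symmetric about each of its critical points. -/
lemma symmetric_of_critical (hA : 0 ≤ A) (hB : 0 ≤ B) (hf : Monotone f) (hK : LipschitzWith K f)
    (h : IsTrajectory A B f v w y q) (hM : ∀ t, v t ≤ M) (h0 : ∀ t, 0 ≤ v t) (hw : w t₀ = 0)
    (t : ℝ) : v (2 * t₀ - t) = v t := by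
  have e : 2 * t₀ - t₀ = t₀ := by ring
  exact (eq_of_bounded hA hB hf hK (h.reflect (2 * t₀)) h (fun t => hM _) (fun t => h0 _) hM h0
    (t₀ := t₀) (by simp [e]) (by simp [e, hw]) t).1

/-- The composition of the reflections about `s` and `t` is the translation by `2 (t - s)`. -/
lemma periodic_of_critical (hA : 0 ≤ A) (hB : 0 ≤ B) (hf : Monotone f) (hK : LipschitzWith K f)
    (h : IsTrajectory A B f v w y q) (hM : ∀ t, v t ≤ M) (h0 : ∀ t, 0 ≤ v t) {s t : ℝ}
    (hs : w s = 0) (ht : w t = 0) : Function.Periodic v (2 * (t - s)) := by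
  intro x
  rw [← symmetric_of_critical hA hB hf hK h hM h0 hs x,
    ← symmetric_of_critical hA hB hf hK h hM h0 ht (2 * s - x)]
  congr 1
  ring

/-- A positive value of `y` would make `v` unbounded in the direction of time in which `y` is
nondecreasing at that point. -/
lemma y_nonpos_of_bounded (hA : 0 ≤ A) (hB : 0 ≤ B) (h : IsTrajectory A B f v w y q)
    (hM : ∀ t, v t ≤ M) (h0 : ∀ t, 0 ≤ v t) (hf : ∀ t, 0 ≤ f (v t)) (t : ℝ) : y t ≤ 0 := by
  by_contra! hcon
  rcases le_total 0 (q t) with hq | hq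
  · obtain ⟨-, h2⟩ := unbounded_of_pos hA hB h (fun s _ => h0 s) (fun s _ => hf s) hcon hq
    obtain ⟨s, -, h3⟩ := h2 M
    exact absurd (hM s) (not_le.2 (h3 s le_rfl).2)
  · have e : 2 * t - t = t := by ring
    obtain ⟨-, h2⟩ := unbounded_of_pos hA hB (h.reflect (2 * t)) (t₀ := t) (fun s _ => h0 _)
      (fun s _ => hf _) (by simpa [e] using hcon) (by simpa [e] using hq)
    obtain ⟨s, -, h3⟩ := h2 M
    exact absurd (hM _) (not_le.2 (h3 s le_rfl).2)

end IsTrajectory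

/-- A constant bounding `B v - v''` by `v` along positive trajectories. -/
noncomputable def harnackConst (A B : ℝ) : ℝ := Real.exp √A * ((B + 2 * √B) * Real.exp √B)

/-- A constant bounding the nonlinearity along positive trajectories. -/
noncomputable def sourceConst (A B : ℝ) : ℝ :=
  (A + 2 * √A) * Real.exp √A * harnackConst A B

namespace IsTrajectory

variable {A B M m t₀ : ℝ} {K : NNReal} {f v w y q : ℝ → ℝ}

lemma abs_w_le (hB : 0 ≤ B) (h : IsTrajectory A B f v w y q) (h0 : ∀ t, 0 ≤ v t)
    (hy : ∀ t, y t ≤ 0) (t : ℝ) : |w t| ≤ √B * v t :=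
  abs_deriv_le_of_deriv_deriv_le (Real.sqrt_nonneg B) h.hasDerivAt_v h.hasDerivAt_w
    (fun s => by rw [Real.sq_sqrt hB]; linarith [hy s]) h0 t

/-- A priori estimates for nonnegative trajectories with `v'' ≤ B v`. -/
lemma harnack (hA : 0 ≤ A) (hB : 0 ≤ B) (h : IsTrajectory A B f v w y q) (h0 : ∀ t, 0 ≤ v t)
    (hy : ∀ t, y t ≤ 0) (hf0 : ∀ t, 0 ≤ f (v t)) (hf : MonotoneOn f (Ici 0)) (t : ℝ) :
    -y t ≤ harnackConst A B * v t ∧ f (Real.exp (-√B) * v t) ≤ sourceConst A B * v t := by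
  have hw := abs_w_le hB h h0 hy
  have hq : ∀ t, |(-q t)| ≤ √A * (-y t) :=
    abs_deriv_le_of_deriv_deriv_le (Real.sqrt_nonneg A) (fun s => (h.hasDerivAt_y s).neg)
      (fun s => (h.hasDerivAt_q s).neg)
      (fun s => by rw [Real.sq_sqrt hA]; linarith [hf0 s]) (fun s => by simpa using hy s)
  have hb := Real.sqrt_nonneg B
  have ha := Real.sqrt_nonneg A
  have htt : t ≤ t + 1 := by linarith
  have hv1 : ∀ s ∈ Icc t (t + 1),
      Real.exp (-√B) * v t ≤ v s ∧ v s ≤ Real.exp √B * v t := by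
    intro s hs
    obtain ⟨h1, h2⟩ := exp_mul_le_of_abs_deriv_le h.hasDerivAt_v hw hs.1
    constructor
    · refine le_trans (mul_le_mul_of_nonneg_right (Real.exp_le_exp.2 ?_) (h0 t)) h1
      nlinarith [hs.2]
    · refine h2.trans (mul_le_mul_of_nonneg_right (Real.exp_le_exp.2 ?_) (h0 t))
      nlinarith [hs.2]
  have hy1 : ∀ s ∈ Icc t (t + 1),
      Real.exp (-√A) * -y t ≤ -y s ∧ -y s ≤ Real.exp √A * -y t := by
    intro s hs
    obtain ⟨h1, h2⟩ := exp_mul_le_of_abs_deriv_le (Y := fun s => -y s)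
      (fun s => (h.hasDerivAt_y s).fun_neg) hq hs.1
    have hyt : 0 ≤ -y t := by linarith [hy t]
    constructor
    · refine le_trans (mul_le_mul_of_nonneg_right (Real.exp_le_exp.2 ?_) hyt) h1
      nlinarith [hs.2]
    · refine h2.trans (mul_le_mul_of_nonneg_right (Real.exp_le_exp.2 ?_) hyt)
      nlinarith [hs.2]
  have hmem : t + 1 ∈ Icc t (t + 1) := ⟨htt, le_rfl⟩
  have hmem' : t ∈ Icc t (t + 1) := ⟨le_rfl, htt⟩
  have h1 : -y t ≤ harnackConst A B * v t := by
    -- `w' = B v + y` is integrated over a unit interval, on which `v` and `-y` vary by bounded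
    -- factors; at both ends `|w| ≤ √B v`, so `-y` cannot be large compared with `v`.
    have h2 := le_add_mul_of_hasDerivAt_le (c := B * (Real.exp √B * v t) - Real.exp (-√A) * -y t)
      htt (fun s _ => h.hasDerivAt_w s) (fun s hs => by
        have := mul_le_mul_of_nonneg_left (hv1 s hs).2 hB
        linarith [(hy1 s hs).1])
    have h3 := (abs_le.1 (hw (t + 1))).1
    have h4 := (abs_le.1 (hw t)).2
    have h5 := mul_le_mul_of_nonneg_left (hv1 _ hmem).2 hb
    have h6 := mul_le_mul_of_nonneg_left (hv1 _ hmem').2 hb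
    have h7 : Real.exp (-√A) * -y t ≤ (B + 2 * √B) * Real.exp √B * v t := by linarith
    have h8 := mul_le_mul_of_nonneg_left h7 (Real.exp_pos √A).le
    rw [← mul_assoc, ← Real.exp_add, add_neg_cancel, Real.exp_zero, one_mul] at h8
    rw [harnackConst]
    linarith
  refine ⟨h1, ?_⟩
  -- The same argument one level up: integrating `q' = A y + f(v)` bounds the source by `-y`, hence
  -- by `v`.
  have h2 := le_add_mul_of_hasDerivAt_le (f := fun s => -q s)
    (c := A * (Real.exp √A * -y t) - f (Real.exp (-√B) * v t))
    htt (fun s _ => (h.hasDerivAt_q s).fun_neg) (fun s hs => by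
      have h3 := mul_le_mul_of_nonneg_left (hy1 s hs).2 hA
      have h4 := hf (mul_nonneg (Real.exp_pos _).le (h0 t)) (h0 s) (hv1 s hs).1
      linarith)
  have h3 := (abs_le.1 (hq (t + 1))).1
  have h4 := (abs_le.1 (hq t)).2
  have h5 := mul_le_mul_of_nonneg_left (hy1 _ hmem).2 ha
  have h6 := mul_le_mul_of_nonneg_left (hy1 _ hmem').2 ha
  have h7 : f (Real.exp (-√B) * v t) ≤ (A + 2 * √A) * Real.exp √A * -y t := by
    beta_reduce at h2
    linarith
  refine h7.trans ?_
  rw [sourceConst, mul_assoc ((A + 2 * √A) * Real.exp √A)]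
  exact mul_le_mul_of_nonneg_left h1 (by positivity)

/-- Second order reduction: `r = y - A v` satisfies `r'' = f(v) - A B v`. -/
lemma hasDerivAt_reduced (h : IsTrajectory A B f v w y q) :
    (∀ t, HasDerivAt (fun s => y s - A * v s) (q t - A * w t) t) ∧
      ∀ t, HasDerivAt (fun s => q s - A * w s) (f (v t) - A * B * v t) t := by
  refine ⟨fun t => (h.hasDerivAt_y t).sub ((h.hasDerivAt_v t).const_mul A), fun t => ?_⟩
  exact ((h.hasDerivAt_q t).sub ((h.hasDerivAt_w t).const_mul A)).congr_deriv (by ring)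

lemma reduced_bound (hA : 0 ≤ A) (hB : 0 ≤ B) (h : IsTrajectory A B f v w y q)
    (hM : ∀ t, v t ≤ M) (h0 : ∀ t, 0 ≤ v t) (hf0 : ∀ t, 0 ≤ f (v t)) (hf : MonotoneOn f (Ici 0))
    (t : ℝ) : y t - A * v t ≤ 0 ∧ -(y t - A * v t) ≤ (harnackConst A B + A) * M := by
  have hy := y_nonpos_of_bounded hA hB h hM h0 hf0
  have h1 := (harnack hA hB h h0 hy hf0 hf t).1
  have h2 := mul_nonneg hA (h0 t)
  have h3 : 0 ≤ harnackConst A B := by rw [harnackConst]; positivity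
  have h4 := mul_le_mul_of_nonneg_left (hM t) (add_nonneg h3 hA)
  exact ⟨by linarith [hy t], by linarith⟩

/-- The one-sided inequality makes `r = y - A v` convex or concave on the whole line; being bounded
it is constant, so `r'' = f(v) - A B v` vanishes. -/
lemma eq_of_le_source (hA : 0 ≤ A) (hB : 0 ≤ B) (h : IsTrajectory A B f v w y q)
    (hM : ∀ t, v t ≤ M) (h0 : ∀ t, 0 ≤ v t) (hf0 : ∀ t, 0 ≤ f (v t)) (hf : MonotoneOn f (Ici 0))
    (hle : (∀ t, A * B * v t ≤ f (v t)) ∨ ∀ t, f (v t) ≤ A * B * v t) (t : ℝ) :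
    f (v t) = A * B * v t := by
  obtain ⟨hr, hs⟩ := h.hasDerivAt_reduced
  have hb := reduced_bound hA hB h hM h0 hf0 hf
  have hzero : ∀ t, q t - A * w t = 0 := by
    rcases hle with hle | hle
    · exact deriv_eq_zero_of_bddAbove_of_convex hr hs (fun t => by linarith [hle t])
        (fun t => (hb t).1)
    · intro t
      have := deriv_eq_zero_of_bddAbove_of_convex (fun t => (hr t).fun_neg)
        (fun t => (hs t).fun_neg) (fun t => by linarith [hle t]) (fun t => (hb t).2) t
      linarith
  have h1 : HasDerivAt (fun s => q s - A * w s) 0 t := by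
    rw [show (fun s => q s - A * w s) = fun _ => 0 from funext hzero]
    exact hasDerivAt_const t 0
  linarith [(hs t).unique h1]

/-- If the limit were not an equilibrium, `r''` would eventually be bounded away from zero with a
fixed sign and the bounded function `r = y - A v` would diverge. -/
lemma eq_of_tendsto (hA : 0 ≤ A) (hB : 0 ≤ B) (h : IsTrajectory A B f v w y q)
    (hM : ∀ t, v t ≤ M) (h0 : ∀ t, 0 ≤ v t) (hf0 : ∀ t, 0 ≤ f (v t)) (hf : MonotoneOn f (Ici 0))
    {l : ℝ} (hl : Tendsto v atTop (𝓝 l)) (hc : ContinuousAt f l) : f l = A * B * l := by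
  obtain ⟨hr, hs⟩ := h.hasDerivAt_reduced
  have hb := reduced_bound hA hB h hM h0 hf0 hf
  have hlim : Tendsto (fun t => f (v t) - A * B * v t) atTop (𝓝 (f l - A * B * l)) :=
    (hc.tendsto.comp hl).sub (hl.const_mul _)
  rcases lt_trichotomy (f l) (A * B * l) with hlt | heq | hgt
  · exfalso
    have hev := hlim.eventually_lt_const (show f l - A * B * l < (f l - A * B * l) / 2 by linarith)
    obtain ⟨T, hT⟩ := eventually_atTop.1 hev
    obtain ⟨t₁, -, h3⟩ := exists_lt_of_le_deriv_deriv (f := fun s => -(y s - A * v s)) (t₀ := T)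
      (c := -((f l - A * B * l) / 2)) (by linarith) (fun t _ => (hr t).fun_neg)
      (fun t _ => (hs t).fun_neg) (fun t ht => by linarith [hT t ht]) ((harnackConst A B + A) * M)
    have := h3 t₁ le_rfl
    linarith [(hb t₁).2]
  · exact heq
  · exfalso
    have hev := hlim.eventually_const_lt (show (f l - A * B * l) / 2 < f l - A * B * l by linarith)
    obtain ⟨T, hT⟩ := eventually_atTop.1 hev
    obtain ⟨t₁, -, h3⟩ := exists_lt_of_le_deriv_deriv (f := fun s => y s - A * v s) (t₀ := T)
      (c := (f l - A * B * l) / 2) (by linarith) (fun t _ => hr t)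
      (fun t _ => hs t) (fun t ht => by linarith [hT t ht]) 0
    have := h3 t₁ le_rfl
    linarith [(hb t₁).1]

end IsTrajectory

/-! ### Classification of bounded positive trajectories -/

/-- A monotone Lipschitz source term that crosses the line `x ↦ κ x` upwards at `m`. -/
structure IsCrossingSource (K : NNReal) (κ m : ℝ) (f : ℝ → ℝ) : Prop where
  monotone : Monotone f
  lipschitz : LipschitzWith K f
  pos : ∀ x, 0 < x → 0 < f x
  lt : ∀ x, 0 < x → x < m → f x < κ * x
  eq : f m = κ * m
  gt : ∀ x, m < x → κ * x < f x

lemma exists_tendsto_of_monotoneOn_Ici {g : ℝ → ℝ} {t₀ M : ℝ} (hg : MonotoneOn g (Ici t₀))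
    (hM : ∀ t, g t ≤ M) : ∃ l, Tendsto g atTop (𝓝 l) ∧ ∀ t, t₀ ≤ t → g t ≤ l := by
  have hmono : Monotone fun t => g (max t t₀) := fun s t hst =>
    hg (mem_Ici.2 (le_max_right _ _)) (mem_Ici.2 (le_max_right _ _)) (max_le_max_right _ hst)
  have h1 := tendsto_atTop_ciSup hmono ⟨M, by rintro _ ⟨t, rfl⟩; exact hM _⟩
  have h2 : Tendsto g atTop (𝓝 (⨆ t, g (max t t₀))) := by
    refine h1.congr' ?_
    filter_upwards [eventually_ge_atTop t₀] with t ht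
    rw [max_eq_left ht]
  refine ⟨_, h2, fun t ht => ge_of_tendsto h2 ?_⟩
  filter_upwards [eventually_ge_atTop t] with s hs
  exact hg ht (ht.trans hs) hs

lemma forall_pos_or_forall_neg_of_ne_zero {g : ℝ → ℝ} {s : Set ℝ} (hs : IsPreconnected s)
    (hg : ContinuousOn g s) (h0 : ∀ t ∈ s, g t ≠ 0) :
    (∀ t ∈ s, 0 < g t) ∨ ∀ t ∈ s, g t < 0 := by
  by_contra! hcon
  obtain ⟨⟨a, ha, ha'⟩, ⟨b, hb, hb'⟩⟩ := hcon
  obtain ⟨c, hc, hc'⟩ := hs.intermediate_value ha hb hg ⟨ha', hb'⟩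
  exact h0 c hc hc'

namespace IsTrajectory

variable {A B M m t₀ : ℝ} {K : NNReal} {f v w y q : ℝ → ℝ}

lemma monotoneOn_of_w_nonneg (h : IsTrajectory A B f v w y q) {s : Set ℝ} (hs : Convex ℝ s)
    (hw : ∀ t ∈ interior s, 0 ≤ w t) : MonotoneOn v s :=
  monotoneOn_of_hasDerivWithinAt_nonneg hs h.continuous_v.continuousOn
    (fun t _ => (h.hasDerivAt_v t).hasDerivWithinAt) hw

lemma antitoneOn_of_w_nonpos (h : IsTrajectory A B f v w y q) {s : Set ℝ} (hs : Convex ℝ s)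
    (hw : ∀ t ∈ interior s, w t ≤ 0) : AntitoneOn v s :=
  antitoneOn_of_hasDerivWithinAt_nonpos hs h.continuous_v.continuousOn
    (fun t _ => (h.hasDerivAt_v t).hasDerivWithinAt) hw

/-- A positive bounded trajectory staying on one side of the equilibrium is constant. -/
lemma eq_equilibrium (hA : 0 ≤ A) (hB : 0 ≤ B) (hf : IsCrossingSource K (A * B) m f)
    (h : IsTrajectory A B f v w y q) (hM : ∀ t, v t ≤ M) (h0 : ∀ t, 0 < v t)
    (hside : (∀ t, v t ≤ m) ∨ ∀ t, m ≤ v t) (t : ℝ) : v t = m := by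
  have hle : ∀ x, 0 < x → x ≤ m → f x ≤ A * B * x := fun x hx hxm => by
    rcases hxm.lt_or_eq with h1 | rfl
    · exact (hf.lt x hx h1).le
    · exact hf.eq.le
  have hge : ∀ x, m ≤ x → A * B * x ≤ f x := fun x hxm => by
    rcases hxm.lt_or_eq with h1 | rfl
    · exact (hf.gt x h1).le
    · exact hf.eq.ge
  have h1 := eq_of_le_source hA hB h hM (fun t => (h0 t).le) (fun t => (hf.pos _ (h0 t)).le)
    (hf.monotone.monotoneOn _)
    (hside.symm.imp (fun hs t => hge _ (hs t)) (fun hs t => hle _ (h0 t) (hs t))) t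
  rcases lt_trichotomy (v t) m with h2 | h2 | h2
  · exact absurd h1 (hf.lt _ (h0 t) h2).ne
  · exact h2
  · exact absurd h1 (hf.gt _ h2).ne'

/-- After its last critical point, a positive bounded trajectory not tending to zero stays on one
side of the equilibrium. -/
lemma side_of_no_critical (hA : 0 ≤ A) (hB : 0 ≤ B) (hf : IsCrossingSource K (A * B) m f)
    (h : IsTrajectory A B f v w y q) (hM : ∀ t, v t ≤ M) (h0 : ∀ t, 0 < v t)
    (hw : ∀ t, t₀ < t → w t ≠ 0) (hlim : ¬ Tendsto v atTop (𝓝 0)) :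
    (∀ t, t₀ ≤ t → v t ≤ m) ∨ ∀ t, t₀ ≤ t → m ≤ v t := by
  have hl : ∀ l, Tendsto v atTop (𝓝 l) → l = m := by
    intro l hl
    have hl0 : 0 ≤ l := ge_of_tendsto' hl fun t => (h0 t).le
    have hlpos : 0 < l := hl0.lt_of_ne (by rintro rfl; exact hlim hl)
    have h1 := eq_of_tendsto hA hB h hM (fun t => (h0 t).le) (fun t => (hf.pos _ (h0 t)).le)
      (hf.monotone.monotoneOn _) hl hf.lipschitz.continuous.continuousAt
    rcases lt_trichotomy l m with h2 | h2 | h2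
    · exact absurd h1 (hf.lt _ hlpos h2).ne
    · exact h2
    · exact absurd h1 (hf.gt _ h2).ne'
  -- With `w` of constant sign `v` is monotone, hence converges to `m`, and stays on the side from
  -- which it approaches.
  rcases forall_pos_or_forall_neg_of_ne_zero isPreconnected_Ioi h.continuous_w.continuousOn
    (fun t ht => hw t ht) with hs | hs
  · left
    have hmono := h.monotoneOn_of_w_nonneg (convex_Ici t₀)
      (fun t ht => by rw [interior_Ici] at ht; exact (hs t ht).le)
    obtain ⟨l, h1, h2⟩ := exists_tendsto_of_monotoneOn_Ici hmono hM
    rwa [hl l h1] at h2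
  · right
    have hmono := h.antitoneOn_of_w_nonpos (convex_Ici t₀)
      (fun t ht => by rw [interior_Ici] at ht; exact (hs t ht).le)
    obtain ⟨l, h1, h2⟩ := exists_tendsto_of_monotoneOn_Ici (g := fun t => -v t) (M := 0)
      (fun s hs t ht hst => neg_le_neg (hmono hs ht hst)) (fun t => by linarith [h0 t])
    have h3 := hl (-l) (by simpa using h1.neg)
    intro t ht
    linarith [h2 t ht]

/-- If both alternatives fail there is at most one critical point. The trajectory is then on one
side of `m` after it, and before it by symmetry, so it is constant and periodic after all. -/
lemma isPeriodic_or_tendsto_zero (hA : 0 ≤ A) (hB : 0 ≤ B) (hf : IsCrossingSource K (A * B) m f)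
    (h : IsTrajectory A B f v w y q) (hM : ∀ t, v t ≤ M) (h0 : ∀ t, 0 < v t) :
    IsPeriodic v ∨ Tendsto v atTop (𝓝 0) := by
  by_contra! hcon
  obtain ⟨hper, hlim⟩ := hcon
  have hcrit : ∀ s t, w s = 0 → w t = 0 → s = t := by
    intro s t hs ht
    by_contra hne
    wlog hst : s < t generalizing s t
    · exact this t s ht hs (Ne.symm hne) (lt_of_le_of_ne (not_lt.1 hst) (Ne.symm hne))
    exact hper ⟨2 * (t - s), by linarith, periodic_of_critical hA hB hf.monotone hf.lipschitz h hM
      (fun t => (h0 t).le) hs ht⟩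
  have hside : (∀ t, v t ≤ m) ∨ ∀ t, m ≤ v t := by
    by_cases hex : ∃ t₀, w t₀ = 0
    · obtain ⟨t₀, ht₀⟩ := hex
      have hsymm := symmetric_of_critical hA hB hf.monotone hf.lipschitz h hM
        (fun t => (h0 t).le) ht₀
      have hext : ∀ P : ℝ → Prop, (∀ t, t₀ ≤ t → P (v t)) → ∀ t, P (v t) := by
        intro P hP t
        rcases le_total t₀ t with ht | ht
        · exact hP t ht
        · rw [← hsymm]
          exact hP _ (by linarith)
      exact (side_of_no_critical hA hB hf h hM h0
        (fun t ht hwt => ht.ne' (hcrit t t₀ hwt ht₀)) hlim).imp (hext (· ≤ m)) (hext (m ≤ ·))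
    · push Not at hex
      by_contra! hcon
      obtain ⟨⟨a, ha⟩, ⟨b, hb⟩⟩ := hcon
      -- Without critical points any starting time is allowed; `min a b` lies before both times at
      -- which the two sides are violated.
      rcases side_of_no_critical hA hB hf h hM h0 (t₀ := min a b) (fun t _ => hex t) hlim
        with h1 | h1
      · exact absurd (h1 a (min_le_left _ _)) (not_le.2 ha)
      · exact absurd (h1 b (min_le_right _ _)) (not_le.2 hb)
  have hconst := eq_equilibrium hA hB hf h hM h0 hside
  exact hper ⟨1, one_pos, fun t => by rw [hconst, hconst]⟩

/-- A positive bounded trajectory with a critical value below the equilibrium is periodic and the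
critical value is its minimum. -/
lemma isPeriodic_of_critical_lt (hA : 0 ≤ A) (hB : 0 ≤ B) (hf : IsCrossingSource K (A * B) m f)
    (h : IsTrajectory A B f v w y q) (hM : ∀ t, v t ≤ M) (h0 : ∀ t, 0 < v t)
    (hv0 : v 0 < m) (hw0 : w 0 = 0) (hq0 : q 0 = 0) : IsPeriodic v ∧ ∀ t, v 0 ≤ v t := by
  have h0' : ∀ t, 0 ≤ v t := fun t => (h0 t).le
  have hsymm : ∀ t, v (-t) = v t := fun t => by
    simpa using symmetric_of_critical hA hB hf.monotone hf.lipschitz h hM h0' hw0 t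
  have hside : ¬ ((∀ t, v t ≤ m) ∨ ∀ t, m ≤ v t) := fun hs =>
    hv0.ne (eq_equilibrium hA hB hf h hM h0 hs 0)
  have hext : ∀ P : ℝ → Prop, (∀ t, 0 ≤ t → P (v t)) → ∀ t, P (v t) := by
    intro P hP t
    rcases le_total 0 t with ht | ht
    · exact hP t ht
    · rw [← hsymm]
      exact hP _ (by linarith)
  -- If `v''(0) ≤ 0`, then as long as `v ≤ m` the reduced function has `r' = q - A w ≤ 0`, whence
  -- `(-w)'' ≥ (A + B)(-w)`. So `w ≤ 0`, and `v` could never climb to `m`, as it must.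
  have hconv : 0 < B * v 0 + y 0 := by
    by_contra! hb
    obtain ⟨t₁, ht₁, hvt₁⟩ : ∃ t, 0 ≤ t ∧ m < v t := by
      by_contra! hcon
      exact hside (Or.inl (hext (· ≤ m) hcon))
    obtain ⟨s, hs, hvs, hlt⟩ := exists_first_zero (f := fun t => m - v t) ht₁
      (continuous_const.sub h.continuous_v).continuousOn (by linarith) (by linarith)
    have hle : ∀ t ∈ Icc 0 s, v t ≤ m := fun t ht => by
      rcases ht.2.lt_or_eq with h1 | rfl
      · linarith [hlt t ⟨ht.1, h1⟩]
      · linarith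
    obtain ⟨-, hred⟩ := h.hasDerivAt_reduced
    have hneg : ∀ t ∈ Icc 0 s, q t - A * w t ≤ 0 := by
      intro t ht
      have := le_of_hasDerivAt_nonneg ht.1 (fun u _ => (hred u).fun_neg) (fun u hu => by
        have h1 := hle u ⟨hu.1, hu.2.trans ht.2⟩
        rcases h1.lt_or_eq with h2 | h2
        · linarith [hf.lt _ (h0 u) h2]
        · rw [h2, hf.eq]; linarith)
      beta_reduce at this
      rw [hw0, hq0] at this
      linarith
    have hw := le_of_mul_le_deriv_deriv (A := A + B) (t₀ := 0) (T := s) (add_nonneg hA hB)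
      (y := fun t => -w t) (fun t _ => (h.hasDerivAt_w t).fun_neg)
      (fun t _ => ((((h.hasDerivAt_v t).const_mul B).fun_add (h.hasDerivAt_y t))).fun_neg)
      (fun t ht => by linarith [hneg t ht]) (by simp [hw0]) (by linarith)
    have := le_of_hasDerivAt_nonneg hs.1.le (fun t _ => (h.hasDerivAt_v t).fun_neg)
      (fun t ht => by
        have := (hw t ht).1
        rw [hw0] at this
        linarith)
    linarith
  obtain ⟨ε, hε, hwε⟩ : ∃ ε > 0, ∀ t ∈ Ioo 0 ε, 0 < w t := by
    have h1 : ∀ᶠ t in 𝓝 (0 : ℝ), 0 < B * v t + y t :=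
      ((h.continuous_v.const_mul B).add h.continuous_y).continuousAt.eventually_const_lt hconv
    obtain ⟨ε, hε, h2⟩ := Metric.eventually_nhds_iff.1 h1
    refine ⟨ε, hε, fun t ht => ?_⟩
    have h3 := strictMonoOn_of_hasDerivWithinAt_pos (convex_Icc 0 t) h.continuous_w.continuousOn
      (fun s _ => (h.hasDerivAt_w s).hasDerivWithinAt) (fun s hs => by
        rw [interior_Icc] at hs
        refine h2 ?_
        rw [Real.dist_eq, sub_zero, abs_of_pos hs.1]
        exact hs.2.trans ht.2)
    have := h3 (left_mem_Icc.2 ht.1.le) (right_mem_Icc.2 ht.1.le) ht.1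
    rwa [hw0] at this
  obtain ⟨t₁, ht₁, hwt₁⟩ : ∃ t, 0 < t ∧ w t = 0 := by
    by_contra! hcon
    have hnot : ¬ Tendsto v atTop (𝓝 0) := by
      intro hlim
      rcases forall_pos_or_forall_neg_of_ne_zero isPreconnected_Ioi h.continuous_w.continuousOn
        (fun t ht => hcon t ht) with hs | hs
      · have hmono := h.monotoneOn_of_w_nonneg (convex_Ici 0)
          (fun t ht => by rw [interior_Ici] at ht; exact (hs t ht).le)
        have := ge_of_tendsto hlim (b := v 0) (by
          filter_upwards [eventually_ge_atTop 0] with t ht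
          exact hmono self_mem_Ici ht ht)
        linarith [h0 0]
      · exact absurd (hs (ε / 2) (half_pos hε))
          (not_lt.2 (hwε (ε / 2) ⟨half_pos hε, half_lt_self hε⟩).le)
    rcases side_of_no_critical hA hB hf h hM h0 hcon hnot with h1 | h1
    · exact hside (Or.inl (hext (· ≤ m) h1))
    · exact absurd (h1 0 le_rfl) (not_le.2 hv0)
  have hεt : ε / 2 < t₁ := by
    by_contra! hcon
    exact (hwε t₁ ⟨ht₁, by linarith⟩).ne' hwt₁
  -- Since `w 0 = 0`, the search for the next critical point starts at `ε / 2`. On `[0, s]` the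
  -- function `v` is nondecreasing; evenness and the period `2 s` then make `v 0` the global
  -- minimum.
  obtain ⟨s, hs, hws, hpos⟩ := exists_first_zero hεt.le h.continuous_w.continuousOn
    (hwε (ε / 2) ⟨half_pos hε, half_lt_self hε⟩) hwt₁.le
  have hs0 : 0 < s := (half_pos hε).trans hs.1
  have hmono := h.monotoneOn_of_w_nonneg (convex_Icc 0 s) (fun t ht => by
    rw [interior_Icc] at ht
    rcases lt_or_ge t (ε / 2) with h1 | h1
    · exact (hwε t ⟨ht.1, by linarith⟩).le
    · exact (hpos t ⟨h1, ht.2⟩).le)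
  have hper : Function.Periodic v (2 * (s - 0)) :=
    periodic_of_critical hA hB hf.monotone hf.lipschitz h hM h0' hw0 hws
  refine ⟨⟨2 * (s - 0), by linarith, hper⟩, fun t => ?_⟩
  obtain ⟨t', ht', hvt⟩ := hper.exists_mem_Ico (by linarith) t (-s)
  rw [hvt]
  rcases le_total 0 t' with h1 | h1
  · exact hmono (left_mem_Icc.2 hs0.le) ⟨h1, by linarith [ht'.2]⟩ h1
  · rw [← hsymm t']
    exact hmono (left_mem_Icc.2 hs0.le) ⟨by linarith, by linarith [ht'.1]⟩ (by linarith)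

end IsTrajectory

/-! ### The power nonlinearity and its truncation -/

/-- The `C¹` function which equals `x ^ p` on `[0, M]`, vanishes on `(-∞, 0]` and is affine on
`[M, ∞)`. -/
noncomputable def truncPow (p M x : ℝ) : ℝ := ∫ s in (0 : ℝ)..x, p * min (max s 0) M ^ (p - 1)

section truncPow

variable {p M : ℝ}

lemma continuous_truncPow_deriv (hp : 1 < p) :
    Continuous fun s : ℝ => p * min (max s 0) M ^ (p - 1) :=
  continuous_const.mul (((continuous_id.max continuous_const).min continuous_const).rpow_const
    fun _ => Or.inr (by linarith))

lemma hasDerivAt_truncPow (hp : 1 < p) (x : ℝ) :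
    HasDerivAt (truncPow p M) (p * min (max x 0) M ^ (p - 1)) x :=
  ((continuous_truncPow_deriv hp).integral_hasStrictDerivAt 0 x).hasDerivAt

lemma truncPow_deriv_nonneg (hp : 1 < p) (hM : 0 ≤ M) (x : ℝ) :
    0 ≤ p * min (max x 0) M ^ (p - 1) :=
  mul_nonneg (by linarith) (Real.rpow_nonneg (le_min (le_max_right _ _) hM) _)

lemma monotone_truncPow (hp : 1 < p) (hM : 0 ≤ M) : Monotone (truncPow p M) :=
  monotone_of_hasDerivAt_nonneg (hasDerivAt_truncPow hp) (truncPow_deriv_nonneg hp hM)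

lemma lipschitzWith_truncPow (hp : 1 < p) (hM : 0 ≤ M) :
    LipschitzWith (p * M ^ (p - 1)).toNNReal (truncPow p M) := by
  refine lipschitzWith_of_nnnorm_deriv_le (fun x => (hasDerivAt_truncPow hp x).differentiableAt) ?_
  intro x
  rw [(hasDerivAt_truncPow hp x).deriv, ← NNReal.coe_le_coe, coe_nnnorm, Real.norm_eq_abs,
    abs_of_nonneg (truncPow_deriv_nonneg hp hM x), Real.coe_toNNReal']
  refine le_trans ?_ (le_max_left _ _)
  have := Real.rpow_le_rpow (le_min (le_max_right x 0) hM) (min_le_right (max x 0) M)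
    (show 0 ≤ p - 1 by linarith)
  exact mul_le_mul_of_nonneg_left this (by linarith)

lemma contDiff_truncPow (hp : 1 < p) : ContDiff ℝ 1 (truncPow p M) := by
  rw [contDiff_one_iff_deriv]
  refine ⟨fun x => (hasDerivAt_truncPow hp x).differentiableAt, ?_⟩
  rw [show deriv (truncPow p M) = _ from funext fun x => (hasDerivAt_truncPow hp x).deriv]
  exact continuous_truncPow_deriv hp

lemma truncPow_eq_rpow (hp : 1 < p) {x : ℝ} (hx : 0 ≤ x) (hxM : x ≤ M) :
    truncPow p M x = x ^ p := by
  have h0 : truncPow p M 0 = 0 := by simp [truncPow]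
  have hd : ∀ t ∈ Icc 0 x, HasDerivAt (fun s => truncPow p M s - s ^ p) 0 t := by
    intro t ht
    refine ((hasDerivAt_truncPow hp t).sub
      (Real.hasDerivAt_rpow_const (Or.inr hp.le))).congr_deriv ?_
    rw [max_eq_left ht.1, min_eq_left (ht.2.trans hxM), sub_self]
  have h1 := le_of_hasDerivAt_nonneg hx hd (fun _ _ => le_rfl)
  have h2 := le_of_hasDerivAt_nonneg hx (fun t ht => (hd t ht).fun_neg)
    (fun _ _ => by simp)
  beta_reduce at h1 h2
  rw [h0, Real.zero_rpow (by linarith)] at h1 h2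
  linarith

lemma mul_rpow_sub_one (hp : 1 < p) {x : ℝ} (hx : 0 ≤ x) : x * x ^ (p - 1) = x ^ p := by
  rcases hx.eq_or_lt with rfl | hx
  · rw [zero_mul, Real.zero_rpow (by linarith)]
  · rw [Real.rpow_sub_one hx.ne', mul_div_cancel₀ _ hx.ne']

/-- The form in which superlinearity survives truncation: beyond `M` the slope `p M^(p-1)` exceeds
`M^(p-1)`. -/
lemma mul_min_rpow_le_truncPow (hp : 1 < p) (hM : 0 ≤ M) {x : ℝ} (hx : 0 ≤ x) :
    x * min x M ^ (p - 1) ≤ truncPow p M x := by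
  rcases le_total x M with h | h
  · rw [min_eq_left h, truncPow_eq_rpow hp hx h, mul_rpow_sub_one hp hx]
  · rw [min_eq_right h]
    have h1 := add_mul_le_of_le_hasDerivAt (c := p * M ^ (p - 1)) h
      (fun t _ => hasDerivAt_truncPow (M := M) hp t)
      (fun t ht => by rw [max_eq_left (hM.trans ht.1), min_eq_right ht.1])
    rw [truncPow_eq_rpow hp hM le_rfl, ← mul_rpow_sub_one hp hM] at h1
    have h2 : 0 ≤ (p - 1) * M ^ (p - 1) * (x - M) :=
      mul_nonneg (mul_nonneg (by linarith) (Real.rpow_nonneg hM _)) (by linarith)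
    linarith

lemma isCrossingSource_truncPow (hp : 1 < p) {κ m : ℝ} (hm : 0 < m) (hκ : m ^ (p - 1) = κ)
    (hM : m < M) : IsCrossingSource (p * M ^ (p - 1)).toNNReal κ m (truncPow p M) := by
  have hM0 : 0 < M := hm.trans hM
  have hp1 : 0 < p - 1 := by linarith
  refine ⟨monotone_truncPow hp hM0.le, lipschitzWith_truncPow hp hM0.le, ?_, ?_, ?_, ?_⟩
  · intro x hx
    refine lt_of_lt_of_le ?_ (mul_min_rpow_le_truncPow hp hM0.le hx.le)
    exact mul_pos hx (Real.rpow_pos_of_pos (lt_min hx hM0) _)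
  · intro x hx hxm
    rw [truncPow_eq_rpow hp hx.le (hxm.trans hM).le, ← mul_rpow_sub_one hp hx.le, ← hκ, mul_comm]
    exact mul_lt_mul_of_pos_right (Real.rpow_lt_rpow hx.le hxm hp1) hx
  · rw [truncPow_eq_rpow hp hm.le hM.le, ← mul_rpow_sub_one hp hm.le, ← hκ, mul_comm]
  · intro x hx
    have hx0 : 0 < x := hm.trans hx
    refine lt_of_lt_of_le ?_ (mul_min_rpow_le_truncPow hp hM0.le hx0.le)
    rw [← hκ, mul_comm]
    exact mul_lt_mul_of_pos_left (Real.rpow_lt_rpow hm.le (lt_min hx hM) hp1) hx0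

end truncPow

/-- A bound for positive trajectories with a superlinear source. -/
noncomputable def aprioriBound (A B p : ℝ) : ℝ :=
  Real.exp √B * (sourceConst A B * Real.exp √B) ^ (1 / (p - 1))

namespace IsTrajectory

variable {A B M m p t₀ : ℝ} {f v w y q : ℝ → ℝ}

/-- The Harnack estimate bounds the source linearly in `v`, while `hsup` makes it superlinear up to
`M`. As `M` exceeds the resulting bound, the capped range beyond `M` is never reached, and the bound
does not depend on `M`. -/
lemma le_aprioriBound (hA : 0 ≤ A) (hB : 0 ≤ B) (hp : 1 < p) (h : IsTrajectory A B f v w y q)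
    (h0 : ∀ t, 0 < v t) (hy : ∀ t, y t ≤ 0) (hf0 : ∀ t, 0 ≤ f (v t)) (hf : MonotoneOn f (Ici 0))
    (hM : aprioriBound A B p < M) (hsup : ∀ x, 0 ≤ x → x * min x M ^ (p - 1) ≤ f x) (t : ℝ) :
    v t ≤ aprioriBound A B p := by
  have h1 := (harnack hA hB h (fun s => (h0 s).le) hy hf0 hf t).2
  have hp1 : 0 < p - 1 := by linarith
  have hs : 0 ≤ sourceConst A B := by rw [sourceConst, harnackConst]; positivity
  set R := (sourceConst A B * Real.exp √B) ^ (1 / (p - 1)) with hR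
  have hR0 : 0 ≤ R := by positivity
  set x := Real.exp (-√B) * v t with hx
  have hvx : v t = Real.exp √B * x := by
    rw [hx, ← mul_assoc, ← Real.exp_add, add_neg_cancel, Real.exp_zero, one_mul]
  have hx0 : 0 < x := mul_pos (Real.exp_pos _) (h0 t)
  have hRM : R < M := by
    refine lt_of_le_of_lt ?_ hM
    rw [aprioriBound, ← hR]
    exact le_mul_of_one_le_left hR0 (Real.one_le_exp (Real.sqrt_nonneg _))
  have hM0 : 0 < M := hR0.trans_lt hRM
  have h2 : min x M ^ (p - 1) ≤ sourceConst A B * Real.exp √B := by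
    have h3 := (hsup x hx0.le).trans h1
    rw [hvx] at h3
    refine le_of_mul_le_mul_left ?_ hx0
    linarith
  have h3 : min x M ≤ R := by
    have h4 := Real.rpow_le_rpow (Real.rpow_nonneg (le_min hx0.le hM0.le) _) h2
      (show 0 ≤ 1 / (p - 1) by positivity)
    rwa [← Real.rpow_mul (le_min hx0.le hM0.le), mul_one_div_cancel hp1.ne', Real.rpow_one] at h4
  have h4 : x ≤ R := (min_le_iff.1 h3).resolve_right (not_le.2 hRM)
  rw [hvx, aprioriBound]
  exact mul_le_mul_of_nonneg_left h4 (Real.exp_pos _).le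

lemma congr_source {g : ℝ → ℝ} (h : IsTrajectory A B f v w y q) (hfg : ∀ t, f (v t) = g (v t)) :
    IsTrajectory A B g v w y q :=
  ⟨h.hasDerivAt_v, h.hasDerivAt_w, h.hasDerivAt_y, fun t => hfg t ▸ h.hasDerivAt_q t⟩

/-- A positive global trajectory with power source cannot escape to infinity. -/
lemma y_nonpos_of_rpow (hA : 0 ≤ A) (hB : 0 ≤ B) (hp : 1 < p)
    (h : IsTrajectory A B (fun x => x ^ p) v w y q) (h0 : ∀ t, 0 < v t) (t : ℝ) : y t ≤ 0 := by
  by_contra! hcon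
  wlog hq : 0 ≤ q t generalizing v w y q
  · have e : 2 * t - t = t := by ring
    exact this (h.reflect (2 * t)) (fun s => h0 _) (by simpa [e] using hcon)
      (by simp only [e]; linarith)
  obtain ⟨hyq, hun⟩ := unbounded_of_pos hA hB h (fun s _ => (h0 s).le)
    (fun s _ => Real.rpow_nonneg (h0 s).le p) hcon hq
  obtain ⟨T, hT, hwT⟩ := hun 0
  have hmono : MonotoneOn v (Ici T) := h.monotoneOn_of_w_nonneg (convex_Ici T)
    (fun s hs => (hwT s (interior_subset hs)).1.le)
  have hy0 : ∀ s, T ≤ s → 0 ≤ y s := fun s hs => hcon.le.trans (hyq s (hT.trans hs)).1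
  have hq0 : ∀ s, T ≤ s → 0 ≤ q s := fun s hs => hq.trans (hyq s (hT.trans hs)).2
  -- The source is at least `v(s)^p` after time `s`; it is integrated four times, each over a
  -- further interval of length `h`.
  have hstep : ∀ s, T ≤ s → ∀ h : ℝ, 0 ≤ h → v s + h ^ 4 * v s ^ p ≤ v (s + 4 * h) := by
    intro s hs d hd
    have hvp : ∀ u, s ≤ u → v s ^ p ≤ v u ^ p := fun u hu =>
      Real.rpow_le_rpow (h0 s).le (hmono (mem_Ici.2 hs) (mem_Ici.2 (hs.trans hu)) hu) (by linarith)
    have h1 : ∀ u, s + d ≤ u → d * v s ^ p ≤ q u := by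
      intro u hu
      have h2 := add_mul_le_of_le_hasDerivAt (c := v s ^ p) (show s ≤ u by linarith)
        (fun x _ => h.hasDerivAt_q x) (fun x hx => by
          have := mul_nonneg hA (hy0 x (hs.trans hx.1))
          linarith [hvp x hx.1])
      have h3 : v s ^ p * d ≤ v s ^ p * (u - s) :=
        mul_le_mul_of_nonneg_left (by linarith) (Real.rpow_nonneg (h0 s).le _)
      linarith [hq0 s hs]
    have hc0 : 0 ≤ v s ^ p := Real.rpow_nonneg (h0 s).le _
    have h2 : ∀ u, s + 2 * d ≤ u → d ^ 2 * v s ^ p ≤ y u := by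
      intro u hu
      have h2 := add_mul_le_of_le_hasDerivAt (c := d * v s ^ p) (show s + d ≤ u by linarith)
        (fun x _ => h.hasDerivAt_y x) (fun x hx => h1 x hx.1)
      have h3 : d * v s ^ p * d ≤ d * v s ^ p * (u - (s + d)) :=
        mul_le_mul_of_nonneg_left (by linarith) (by positivity)
      linarith [hy0 (s + d) (by linarith)]
    have h3 : ∀ u, s + 3 * d ≤ u → d ^ 3 * v s ^ p ≤ w u := by
      intro u hu
      have h2 := add_mul_le_of_le_hasDerivAt (c := d ^ 2 * v s ^ p)
        (show s + 2 * d ≤ u by linarith) (fun x _ => h.hasDerivAt_w x) (fun x hx => by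
          have := mul_nonneg hB (h0 x).le
          linarith [h2 x hx.1])
      have h3 : d ^ 2 * v s ^ p * d ≤ d ^ 2 * v s ^ p * (u - (s + 2 * d)) :=
        mul_le_mul_of_nonneg_left (by linarith) (by positivity)
      linarith [(hwT (s + 2 * d) (by linarith)).1]
    have h4 := add_mul_le_of_le_hasDerivAt (c := d ^ 3 * v s ^ p)
      (show s + 3 * d ≤ s + 4 * d by linarith) (fun x _ => h.hasDerivAt_v x)
      (fun x hx => h3 x hx.1)
    have h5 := hmono (mem_Ici.2 hs) (mem_Ici.2 (by linarith : T ≤ s + 3 * d)) (by linarith)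
    linarith
  -- doubling times form a convergent geometric series
  set e : ℝ := (p - 1) / 4 with he
  have hepos : 0 < e := by rw [he]; linarith
  set θ : ℝ := 2 ^ (-e) with hθ
  have hθ0 : 0 < θ := Real.rpow_pos_of_pos two_pos _
  have hθ1 : θ < 1 := Real.rpow_lt_one_of_one_lt_of_neg one_lt_two (by linarith)
  set S : ℝ := T + 4 / (1 - θ) * v T ^ (-e) with hS
  have hC : 0 < 4 / (1 - θ) := div_pos four_pos (by linarith)
  -- The exponent `e` makes `d = v(s)^(-e)` satisfy `d⁴ v(s)^p = v(s)`, so `v` at least doubles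
  -- within time `4 d`. Then `v^(-e)` shrinks at least by the factor `θ`, so the displayed quantity
  -- does not increase and every doubling occurs before time `S`.
  have hseq : ∀ k : ℕ, ∃ s, T ≤ s ∧ s + 4 / (1 - θ) * v s ^ (-e) ≤ S ∧ 2 ^ k * v T ≤ v s := by
    intro k
    induction k with
    | zero => exact ⟨T, le_rfl, le_rfl, by simp⟩
    | succ k ih =>
      obtain ⟨s, hs, hsS, hvs⟩ := ih
      set d := v s ^ (-e) with hd
      have hd0 : 0 < d := Real.rpow_pos_of_pos (h0 s) _
      have h1 : v s + d ^ 4 * v s ^ p ≤ v (s + 4 * d) := hstep s hs d hd0.le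
      have h2 : d ^ 4 * v s ^ p = v s := by
        rw [hd, ← Real.rpow_natCast, ← Real.rpow_mul (h0 s).le, ← Real.rpow_add (h0 s)]
        have : -e * ((4 : ℕ) : ℝ) + p = 1 := by rw [he]; push_cast; ring
        rw [this, Real.rpow_one]
      have h3 : 2 * v s ≤ v (s + 4 * d) := by linarith
      have h4 : v (s + 4 * d) ^ (-e) ≤ θ * d := by
        rw [hθ, hd, ← Real.mul_rpow two_pos.le (h0 s).le]
        exact Real.rpow_le_rpow_of_nonpos (by linarith [h0 s]) h3 (by linarith)
      refine ⟨s + 4 * d, by linarith, ?_, by rw [pow_succ]; linarith⟩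
      have h5 := mul_le_mul_of_nonneg_left h4 hC.le
      have h6 : 4 * d + 4 / (1 - θ) * (θ * d) = 4 / (1 - θ) * d := by
        field_simp [show (1 - θ) ≠ 0 by linarith]
        ring
      linarith
  have hST : ∀ k : ℕ, 2 ^ k * v T ≤ v S := by
    intro k
    obtain ⟨s, hs, hsS, hvs⟩ := hseq k
    have h1 : s ≤ S := le_trans (by
      have := mul_nonneg hC.le (Real.rpow_nonneg (h0 s).le (-e))
      linarith) hsS
    exact hvs.trans (hmono (mem_Ici.2 hs) (mem_Ici.2 (hs.trans h1)) h1)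
  obtain ⟨k, hk⟩ := pow_unbounded_of_one_lt (v S / v T) one_lt_two
  rw [div_lt_iff₀ (h0 T)] at hk
  exact absurd (hST k) (not_le.2 hk)

/-- A positive trajectory tending to zero decays faster than `e^{-γ t}` if `γ² < A ≤ B`. -/
lemma tendsto_exp_mul_zero {γ : ℝ} (hγ : 0 ≤ γ) (hγA : γ ^ 2 < A) (hAB : A ≤ B) (hp : 1 < p)
    (h : IsTrajectory A B (fun x => x ^ p) v w y q) (h0 : ∀ t, 0 < v t) (hM : ∀ t, v t ≤ M)
    (hlim : Tendsto v atTop (𝓝 0)) :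
    Tendsto (fun t => Real.exp (γ * t) * v t) atTop (𝓝 0) := by
  have hA : 0 ≤ A := (sq_nonneg γ).trans hγA.le
  have hB : 0 ≤ B := hA.trans hAB
  have hy : ∀ t, y t ≤ 0 := y_nonpos_of_rpow hA hB hp h h0
  have hyb := fun t => (harnack hA hB h (fun s => (h0 s).le) hy
    (fun s => Real.rpow_nonneg (h0 s).le p)
    (fun a ha b _ hab => Real.rpow_le_rpow ha hab (by linarith)) t).1
  set κ := √((γ ^ 2 + A) / 2) with hκ
  have hκ2 : κ ^ 2 = (γ ^ 2 + A) / 2 := Real.sq_sqrt (by positivity)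
  have hκγ : γ < κ := Real.lt_sqrt_of_sq_lt (by linarith)
  have hκ0 : 0 < κ := hγ.trans_lt hκγ
  -- With this weight, `W = θ v - y` satisfies `W'' - κ² W = θ (B - κ²) v - v^p`: the terms in `y`
  -- cancel, and the rest is nonnegative once `v` is small.
  set θ := A - κ ^ 2 with hθ
  have hθ0 : 0 < θ := by linarith
  have hθB : 0 < θ * (B - κ ^ 2) := mul_pos hθ0 (by linarith)
  have hW : ∀ t, HasDerivAt (fun s => θ * v s - y s) (θ * w t - q t) t := fun t =>
    ((h.hasDerivAt_v t).const_mul θ).sub (h.hasDerivAt_y t)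
  have hW' : ∀ t, HasDerivAt (fun s => θ * w s - q s)
      (θ * (B * v t + y t) - (A * y t + v t ^ p)) t := fun t =>
    ((h.hasDerivAt_w t).const_mul θ).sub (h.hasDerivAt_q t)
  obtain ⟨T, hT⟩ : ∃ T, ∀ t, T ≤ t →
      κ ^ 2 * (θ * v t - y t) ≤ θ * (B * v t + y t) - (A * y t + v t ^ p) := by
    have hl : Tendsto (fun t => v t ^ (p - 1)) atTop (𝓝 0) := by
      have := hlim.rpow_const (p := p - 1) (Or.inr (by linarith))
      rwa [Real.zero_rpow (by linarith)] at this
    obtain ⟨T, hT⟩ := eventually_atTop.1 (hl.eventually_lt_const hθB)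
    refine ⟨T, fun t ht => ?_⟩
    have h1 := mul_le_mul_of_nonneg_left (hT t ht).le (h0 t).le
    rw [mul_rpow_sub_one hp (h0 t).le] at h1
    have h2 : θ * y t = A * y t - κ ^ 2 * y t := by rw [hθ]; ring
    linarith
  have hWM : ∀ t, θ * v t - y t ≤ (θ + harnackConst A B) * M := by
    intro t
    have h3 : 0 ≤ harnackConst A B := by rw [harnackConst]; positivity
    have := mul_le_mul_of_nonneg_left (hM t) (add_nonneg hθ0.le h3)
    linarith [hyb t]
  -- `W' + κ W` cannot be positive: it would then grow at least linearly and force the bounded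
  -- function `W` to infinity.
  have hneg : ∀ t, T ≤ t → (θ * w t - q t) + κ * (θ * v t - y t) ≤ 0 := by
    intro t ht
    by_contra! hcon
    have hH : ∀ s, HasDerivAt (fun s => (θ * w s - q s) + κ * (θ * v s - y s))
        ((θ * (B * v s + y s) - (A * y s + v s ^ p)) + κ * (θ * w s - q s)) s := fun s =>
      (hW' s).add ((hW s).const_mul κ)
    have hexp : ∀ u : ℝ, HasDerivAt (fun s => Real.exp (-κ * s)) (Real.exp (-κ * u) * -κ) u :=
      fun u => by simpa using ((hasDerivAt_id u).const_mul (-κ)).exp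
    set H := fun s => (θ * w s - q s) + κ * (θ * v s - y s) with hHdef
    have hHpos : ∀ s, t ≤ s → H t ≤ H s := by
      intro s hs
      have h1 := le_of_hasDerivAt_nonneg hs (fun u _ => (hexp u).fun_mul (hH u)) (fun u hu => by
        have h2 := mul_le_mul_of_nonneg_left (hT u (ht.trans hu.1)) (Real.exp_pos (-κ * u)).le
        simp only [hHdef]
        linarith)
      have h2 : Real.exp (-κ * s) ≤ Real.exp (-κ * t) := Real.exp_le_exp.2 (by nlinarith)
      have h3 : Real.exp (-κ * s) * H t ≤ Real.exp (-κ * t) * H t :=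
        mul_le_mul_of_nonneg_right h2 hcon.le
      exact le_of_mul_le_mul_left (h3.trans h1) (Real.exp_pos _)
    obtain ⟨t₁, ht₁, h1⟩ := exists_lt_of_le_deriv (c := κ * H t) (mul_pos hκ0 hcon)
      (fun s (_ : t ≤ s) => hH s) (fun s hs => by
        have h2 := hT s (ht.trans hs)
        have h3 := mul_le_mul_of_nonneg_left (hHpos s hs) hκ0.le
        simp only [hHdef] at h3 ⊢
        linarith) (κ * ((θ + harnackConst A B) * M) + 1)
    obtain ⟨t₂, -, h2⟩ := exists_lt_of_le_deriv (c := 1) one_pos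
      (fun s (_ : t₁ ≤ s) => hW s) (fun s hs => by
        have h2 := h1 s hs
        have h3 := mul_le_mul_of_nonneg_left (hWM s) hκ0.le
        simp only [hHdef] at h2
        linarith) ((θ + harnackConst A B) * M)
    exact absurd (hWM t₂) (not_le.2 (h2 t₂ le_rfl))
  set D := Real.exp (κ * T) * (θ * v T - y T) / θ with hD
  have hdecay : ∀ t, T ≤ t → Real.exp (γ * t) * v t ≤ D * Real.exp (-(κ - γ) * t) := by
    intro t ht
    have hexp : ∀ u : ℝ, HasDerivAt (fun s => Real.exp (κ * s)) (Real.exp (κ * u) * κ) u :=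
      fun u => by simpa using ((hasDerivAt_id u).const_mul κ).exp
    have h1 := le_of_hasDerivAt_nonneg ht (fun u _ => ((hexp u).fun_mul (hW u)).fun_neg)
      (fun u hu => by
        have := mul_le_mul_of_nonneg_left (hneg u hu.1) (Real.exp_pos (κ * u)).le
        linarith)
    beta_reduce at h1
    have h2 : Real.exp (κ * t) * v t ≤ D := by
      rw [hD, le_div_iff₀ hθ0]
      have := mul_nonneg (Real.exp_pos (κ * t)).le (neg_nonneg.2 (hy t))
      linarith
    have h3 := mul_le_mul_of_nonneg_right h2 (Real.exp_pos (-(κ - γ) * t)).le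
    refine le_trans (le_of_eq ?_) h3
    rw [mul_right_comm, ← Real.exp_add]
    congr 2
    ring
  refine squeeze_zero' (Eventually.of_forall fun t => mul_nonneg (Real.exp_pos _).le (h0 t).le)
    (eventually_atTop.2 ⟨T, hdecay⟩) ?_
  have h1 : Tendsto (fun t : ℝ => -(κ - γ) * t) atTop atBot :=
    tendsto_id.const_mul_atTop_of_neg (by linarith)
  simpa using (Real.tendsto_exp_atBot.comp h1).const_mul D

/-- A positive solution on the whole line is either periodic or decays faster than `e^{-γ t}`. -/
lemma isPeriodic_or_tendsto_exp_mul_zero {γ : ℝ} (hγ : 0 ≤ γ) (hγA : γ ^ 2 < A) (hAB : A ≤ B)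
    (hp : 1 < p) (h : IsTrajectory A B (fun x => x ^ p) v w y q) (h0 : ∀ t, 0 < v t) :
    IsPeriodic v ∨ Tendsto (fun t => Real.exp (γ * t) * v t) atTop (𝓝 0) := by
  have hA : 0 < A := (sq_nonneg γ).trans_lt hγA
  have hB : 0 < B := hA.trans_le hAB
  have hp1 : 0 < p - 1 := by linarith
  have hM := le_aprioriBound hA.le hB.le hp h h0 (y_nonpos_of_rpow hA.le hB.le hp h h0)
    (fun s => Real.rpow_nonneg (h0 s).le p)
    (fun a ha b _ hab => Real.rpow_le_rpow ha hab (by linarith)) (lt_add_one _)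
    (fun x hx => by
      rw [← mul_rpow_sub_one hp hx]
      refine mul_le_mul_of_nonneg_left (Real.rpow_le_rpow (le_min hx ?_) (min_le_left _ _) hp1.le) hx
      rw [aprioriBound, sourceConst, harnackConst]
      positivity)
  set m := (A * B) ^ (1 / (p - 1)) with hm
  have hm0 : 0 < m := Real.rpow_pos_of_pos (mul_pos hA hB) _
  have hκ : m ^ (p - 1) = A * B := by
    rw [hm, ← Real.rpow_mul (mul_pos hA hB).le, one_div_mul_cancel hp1.ne', Real.rpow_one]
  -- The truncation level lies above the equilibrium and above all values of `v`, so `v` is also a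
  -- trajectory for the truncated source.
  have hf := isCrossingSource_truncPow (M := max m (aprioriBound A B p) + 1) hp hm0 hκ
    (by linarith [le_max_left m (aprioriBound A B p)])
  refine (isPeriodic_or_tendsto_zero hA.le hB.le hf (h.congr_source fun t => ?_) hM h0).imp id
    (fun hlim => tendsto_exp_mul_zero hγ hγA hAB hp h h0 hM hlim)
  rw [truncPow_eq_rpow hp (h0 t).le]
  linarith [hM t, le_max_right m (aprioriBound A B p)]

end IsTrajectory

/-! ### Existence of positive trajectories by shooting -/

open scoped Manifold in
/-- A globally Lipschitz `C¹` vector field has global integral curves. -/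
lemma exists_integralCurve_of_lipschitzWith {E : Type*} [NormedAddCommGroup E] [NormedSpace ℝ E]
    [CompleteSpace E] {F : E → E} {K : NNReal} (hF : ContDiff ℝ 1 F) (hK : LipschitzWith K F)
    (x : E) : ∃ γ : ℝ → E, γ 0 = x ∧ ∀ t, HasDerivAt γ (F (γ t)) t := by
  -- The local existence time depends on `K` only, not on the initial point; this uniformity is what
  -- allows the local curves to be continued for all time.
  set ε : NNReal := 1 / (2 * (K + 1)) with hε
  have hε0 : 0 < ε := by positivity
  have hεK : K * ε ≤ 1 / 2 := by
    rw [hε, mul_one_div, div_le_div_iff₀ (by positivity) two_pos]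
    calc K * 2 ≤ (K + 1) * 2 := by gcongr; exact le_self_add
      _ = 1 * (2 * (K + 1)) := by ring
  have hloc : ∀ z : E, ∃ γ : ℝ → E, γ 0 = z ∧
      IsMIntegralCurveOn (I := 𝓘(ℝ, E)) γ F (Ioo (-(ε : ℝ)) ε) := by
    intro z
    -- On the ball of radius `a` the field is at most `‖F z‖ + K a`, and since `K ε ≤ 1/2` this
    -- choice gives `(‖F z‖ + K a) ε ≤ a`.
    set a : NNReal := 2 * ε * ‖F z‖₊ with ha
    have hpl : IsPicardLindelof (fun _ => F)
        (⟨0, by simp⟩ : Icc (-(ε : ℝ)) ε) z a 0 (‖F z‖₊ + K * a) K := by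
      refine IsPicardLindelof.of_time_independent ?_ hK.lipschitzOnWith ?_
      · intro u hu
        have h1 := hK.dist_le_mul u z
        have h2 : ‖F u‖ ≤ ‖F z‖ + dist (F u) (F z) := by
          rw [dist_eq_norm]; exact norm_le_norm_add_norm_sub' _ _
        have h3 : (K : ℝ) * dist u z ≤ K * a :=
          mul_le_mul_of_nonneg_left (Metric.mem_closedBall.1 hu) K.2
        push_cast
        linarith
      · have h1 : (‖F z‖₊ + K * a) * ε ≤ a := by
          calc (‖F z‖₊ + K * a) * ε = ε * ‖F z‖₊ + (K * ε) * a := by ring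
            _ ≤ ε * ‖F z‖₊ + 1 / 2 * a := by gcongr
            _ = a := by rw [ha]; ring
        have h2 : ((‖F z‖₊ + K * a : NNReal) : ℝ) * ε ≤ a := by exact_mod_cast h1
        simpa using h2
    obtain ⟨γ, h0, h1⟩ := hpl.exists_eq_forall_mem_Icc_hasDerivWithinAt₀
    refine ⟨γ, h0, fun t ht => ?_⟩
    have h2 : HasDerivAt γ (F (γ t)) t :=
      (h1 t (Ioo_subset_Icc_self ht)).hasDerivAt (Icc_mem_nhds ht.1 ht.2)
    exact (h2.hasFDerivAt.hasMFDerivAt).hasMFDerivWithinAt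
  have hsec : ContMDiff 𝓘(ℝ, E) 𝓘(ℝ, E).tangent 1 (fun z : E => (⟨z, F z⟩ : TangentBundle 𝓘(ℝ, E) E)) :=
    contMDiff_vectorSpace_iff_contDiff.2 hF
  obtain ⟨γ, h0, h1⟩ := exists_isMIntegralCurve_of_isMIntegralCurveOn (I := 𝓘(ℝ, E)) hsec
    (NNReal.coe_pos.2 hε0) hloc x
  refine ⟨γ, h0, fun t => ?_⟩
  have h2 : HasFDerivAt γ (ContinuousLinearMap.smulRight (1 : ℝ →L[ℝ] ℝ) (F (γ t))) t :=
    hasMFDerivAt_iff_hasFDerivAt.1 (h1 t)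
  simpa using h2.hasDerivAt

/-- The first order vector field on `ℝ⁴` of `(D² - A)(D² - B) v = f(v)`. -/
def phaseField (A B : ℝ) (f : ℝ → ℝ) (x : ℝ × ℝ × ℝ × ℝ) : ℝ × ℝ × ℝ × ℝ :=
  (x.2.1, B * x.1 + x.2.2.1, x.2.2.2, A * x.2.2.1 + f x.1)

lemma exists_lipschitzWith_phaseField (A B : ℝ) {f : ℝ → ℝ} {K : NNReal}
    (hK : LipschitzWith K f) : ∃ L, LipschitzWith L (phaseField A B f) := by
  have e1 : LipschitzWith 1 fun x : ℝ × ℝ × ℝ × ℝ => x.1 := LipschitzWith.prod_fst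
  have e2 : LipschitzWith 1 fun x : ℝ × ℝ × ℝ × ℝ => x.2.1 := by
    simpa [Function.comp_def] using LipschitzWith.prod_fst.comp LipschitzWith.prod_snd
  have e3 : LipschitzWith 1 fun x : ℝ × ℝ × ℝ × ℝ => x.2.2.1 := by
    simpa [Function.comp_def] using LipschitzWith.prod_fst.comp (LipschitzWith.prod_snd.comp LipschitzWith.prod_snd)
  have e4 : LipschitzWith 1 fun x : ℝ × ℝ × ℝ × ℝ => x.2.2.2 := by
    simpa [Function.comp_def] using LipschitzWith.prod_snd.comp (LipschitzWith.prod_snd.comp LipschitzWith.prod_snd)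
  exact ⟨_, e2.prodMk ((((lipschitzWith_smul B).comp e1).add e3).prodMk
    (e4.prodMk (((lipschitzWith_smul A).comp e3).add (hK.comp e1))))⟩

lemma isTrajectory_iff {A B : ℝ} {f v w y q : ℝ → ℝ} : IsTrajectory A B f v w y q ↔
    ∀ t, HasDerivAt (fun s => (v s, w s, y s, q s)) (phaseField A B f (v t, w t, y t, q t)) t := by
  refine ⟨fun h t => (h.hasDerivAt_v t).prodMk ((h.hasDerivAt_w t).prodMk
    ((h.hasDerivAt_y t).prodMk (h.hasDerivAt_q t))), fun h => ⟨?_, ?_, ?_, ?_⟩⟩ <;> intro t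
  · exact (hasFDerivAt_fst.comp_hasDerivAt t (h t))
  · exact (hasFDerivAt_fst.comp_hasDerivAt t (hasFDerivAt_snd.comp_hasDerivAt t (h t)))
  · exact (hasFDerivAt_fst.comp_hasDerivAt t (hasFDerivAt_snd.comp_hasDerivAt t
      (hasFDerivAt_snd.comp_hasDerivAt t (h t))))
  · exact (hasFDerivAt_snd.comp_hasDerivAt t (hasFDerivAt_snd.comp_hasDerivAt t
      (hasFDerivAt_snd.comp_hasDerivAt t (h t))))

lemma exists_isTrajectory (A B : ℝ) {f : ℝ → ℝ} {K : NNReal} (hf : ContDiff ℝ 1 f)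
    (hK : LipschitzWith K f) (a η : ℝ) : ∃ v w y q, IsTrajectory A B f v w y q ∧
      v 0 = a ∧ w 0 = 0 ∧ y 0 = η ∧ q 0 = 0 := by
  obtain ⟨L, hL⟩ := exists_lipschitzWith_phaseField A B hK
  have hF : ContDiff ℝ 1 (phaseField A B f) := by
    unfold phaseField
    fun_prop
  obtain ⟨γ, h0, h1⟩ := exists_integralCurve_of_lipschitzWith hF hL (a, 0, η, 0)
  refine ⟨fun t => (γ t).1, fun t => (γ t).2.1, fun t => (γ t).2.2.1, fun t => (γ t).2.2.2,
    isTrajectory_iff.2 h1, ?_, ?_, ?_, ?_⟩ <;> simp [h0]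

/-- Lipschitz dependence of trajectories on the initial value of `y`. -/
lemma exists_dist_le_of_isTrajectory (A B : ℝ) {f : ℝ → ℝ} {K : NNReal} (hK : LipschitzWith K f) :
    ∃ L : ℝ, 0 ≤ L ∧ ∀ v₁ w₁ y₁ q₁ v₂ w₂ y₂ q₂ : ℝ → ℝ, IsTrajectory A B f v₁ w₁ y₁ q₁ →
      IsTrajectory A B f v₂ w₂ y₂ q₂ → v₁ 0 = v₂ 0 → w₁ 0 = w₂ 0 → q₁ 0 = q₂ 0 →
      ∀ t, 0 ≤ t → |v₁ t - v₂ t| ≤ |y₁ 0 - y₂ 0| * Real.exp (L * t) ∧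
        |y₁ t - y₂ t| ≤ |y₁ 0 - y₂ 0| * Real.exp (L * t) := by
  obtain ⟨L, hL⟩ := exists_lipschitzWith_phaseField A B hK
  refine ⟨L, L.2, ?_⟩
  intro v₁ w₁ y₁ q₁ v₂ w₂ y₂ q₂ h₁ h₂ hv hw hq t ht
  rw [isTrajectory_iff] at h₁ h₂
  have h := dist_le_of_trajectories_ODE (v := fun _ => phaseField A B f) (fun _ => hL)
    (fun s _ => (h₁ s).continuousAt.continuousWithinAt) (fun s _ => (h₁ s).hasDerivWithinAt)
    (fun s _ => (h₂ s).continuousAt.continuousWithinAt) (fun s _ => (h₂ s).hasDerivWithinAt)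
    (a := 0) (b := t) (δ := |y₁ 0 - y₂ 0|) (by simp [Prod.dist_eq, hv, hw, hq, Real.dist_eq])
    t (right_mem_Icc.2 ht)
  simp only [Prod.dist_eq, sub_zero, max_le_iff, Real.dist_eq] at h
  exact ⟨h.1, h.2.2.1⟩

/-- The conditions are strict on a compact time interval, hence hold with a margin, and exponential
dependence on `η` keeps nearby parameters within it. -/
lemma isOpen_setOf_exit {g h : ℝ → ℝ → ℝ} {L : ℝ} (hL : 0 ≤ L) (hcont : ∀ η, Continuous (h η))
    (hg : ∀ η η' t, 0 ≤ t → |g η t - g η' t| ≤ |η - η'| * Real.exp (L * t))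
    (hh : ∀ η η' t, 0 ≤ t → |h η t - h η' t| ≤ |η - η'| * Real.exp (L * t)) :
    IsOpen {η | ∃ t, 0 ≤ t ∧ g η t < 0 ∧ ∀ s ∈ Icc 0 t, 0 < h η s} := by
  rw [Metric.isOpen_iff]
  rintro η ⟨t, ht, hgt, hpos⟩
  obtain ⟨s₀, hs₀, hmin⟩ := isCompact_Icc.exists_isMinOn (nonempty_Icc.2 ht)
    (hcont η).continuousOn
  have hδ : 0 < min (-g η t) (h η s₀) := lt_min (by linarith) (hpos s₀ hs₀)
  refine ⟨min (-g η t) (h η s₀) / Real.exp (L * t), by positivity, fun η' hη' => ?_⟩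
  rw [Metric.mem_ball, Real.dist_eq, lt_div_iff₀ (Real.exp_pos _)] at hη'
  refine ⟨t, ht, ?_, fun s hs => ?_⟩
  · have h1 := (hg η' η t ht).trans_lt hη'
    linarith [le_abs_self (g η' t - g η t), min_le_left (-g η t) (h η s₀)]
  · have h1 : |η' - η| * Real.exp (L * s) ≤ |η' - η| * Real.exp (L * t) :=
      mul_le_mul_of_nonneg_left (Real.exp_le_exp.2 (mul_le_mul_of_nonneg_left hs.2 hL))
        (abs_nonneg _)
    have h2 := ((hh η' η s hs.1).trans h1).trans_lt hη'
    have h3 : h η s₀ ≤ h η s := hmin hs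
    linarith [neg_abs_le (h η' s - h η s), min_le_right (-g η t) (h η s₀)]

/-- By the second derivative test such a maximum would also be a local minimum, so `g` would be
locally constant and `c = 0`. -/
lemma not_isLocalMax_of_deriv_deriv_pos {g g' : ℝ → ℝ} {s c : ℝ} (hg : ∀ t, HasDerivAt g (g' t) t)
    (hg' : HasDerivAt g' c s) (hc : 0 < c) : ¬ IsLocalMax g s := by
  intro hmax
  have hd : deriv g = g' := funext fun t => (hg t).deriv
  have hmin : IsLocalMin g s := isLocalMin_of_deriv_deriv_pos (by rw [hd, hg'.deriv]; exact hc)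
    hmax.deriv_eq_zero (hg s).continuousAt
  have heq : g =ᶠ[𝓝 s] fun _ => g s := by
    filter_upwards [hmax, hmin] with t h1 h2 using le_antisymm h1 h2
  have h1 := heq.deriv.deriv_eq
  rw [hd, hg'.deriv] at h1
  simp at h1
  exact hc.ne' h1

namespace IsTrajectory

variable {A B M m : ℝ} {K : NNReal} {f v w y q : ℝ → ℝ}

lemma even (hA : 0 ≤ A) (hB : 0 ≤ B) (hf : Monotone f) (hK : LipschitzWith K f)
    (h : IsTrajectory A B f v w y q) (hw : w 0 = 0) (hq : q 0 = 0) (t : ℝ) :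
    v (-t) = v t ∧ y (-t) = y t := by
  have := eq_of_state_eq hA hB hf hK (h.reflect 0) h (t₀ := 0) (by simp) (by simp [hw]) (by simp)
    (by simp [hq]) t
  simp only [zero_sub] at this
  exact ⟨this.1, this.2.2.1⟩

/-- `v` and `y` cannot vanish simultaneously when first leaving the region `v > 0 > y`. -/
lemma not_corner (hA : 0 < A) (hB : 0 ≤ B) (hf : IsCrossingSource K (A * B) m f)
    (h : IsTrajectory A B f v w y q) (hv0 : v 0 < m) (hw : w 0 = 0) (hq : q 0 = 0) {s : ℝ}
    (hs : 0 < s) (hpos : ∀ t ∈ Ico 0 s, 0 < v t ∧ y t < 0) (hvs : v s = 0) (hys : y s = 0) :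
    False := by
  have hev := even hA.le hB hf.monotone hf.lipschitz h hw hq
  have hpos' : ∀ t, -s < t → t < s → 0 < v t ∧ y t < 0 := by
    intro t h1 h2
    rcases le_total 0 t with h3 | h3
    · exact hpos t ⟨h3, h2⟩
    · rw [← (hev t).1, ← (hev t).2]
      exact hpos (-t) ⟨by linarith, by linarith⟩
  -- At a critical point `t` the trajectory and its mirror image are ordered according to the sign
  -- of `q t`. Comparison at time `s` contradicts `y < 0` or `v > 0` at the mirror time `2 t - s`,
  -- which lies inside the region.
  have hcrit : ∀ t ∈ Ioo 0 s, w t ≠ 0 := by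
    intro t ht hwt
    have e : 2 * t - t = t := by ring
    have hin := hpos' (2 * t - s) (by linarith [ht.1]) (by linarith [ht.2])
    rcases le_total (q t) 0 with hqt | hqt
    · have := sub_le_sub hA.le hB hf.monotone hf.lipschitz (h.reflect (2 * t)) h (t₀ := t)
        (by simp [e]) (by simp [e, hwt]) (by simp [e]) (by simp only [e]; linarith) s ht.2.le
      simp only [e, sub_self] at this
      linarith [this.2.2.1]
    · have := sub_le_sub hA.le hB hf.monotone hf.lipschitz h (h.reflect (2 * t)) (t₀ := t)
        (by simp [e]) (by simp [e, hwt]) (by simp [e]) (by simp only [e]; linarith) s ht.2.le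
      simp only [e, sub_self] at this
      linarith [this.1]
  have hanti : AntitoneOn v (Icc 0 s) := by
    rcases forall_pos_or_forall_neg_of_ne_zero isPreconnected_Ioo h.continuous_w.continuousOn hcrit
      with h1 | h1
    · exfalso
      have := h.monotoneOn_of_w_nonneg (convex_Icc 0 s)
        (fun t ht => by rw [interior_Icc] at ht; exact (h1 t ht).le)
        (left_mem_Icc.2 hs.le) (right_mem_Icc.2 hs.le) hs.le
      linarith [(hpos 0 ⟨le_rfl, hs⟩).1]
    · exact h.antitoneOn_of_w_nonpos (convex_Icc 0 s)
        (fun t ht => by rw [interior_Icc] at ht; exact (h1 t ht).le)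
  -- Since `v` decreases and stays below `m`, the function `r = y - A v` is concave with `r'(0) =
  -- 0`; hence `r(s) ≤ r(0) < 0`, whereas the corner has `r(s) = 0`.
  obtain ⟨hr, hred⟩ := h.hasDerivAt_reduced
  have hconc : ∀ t ∈ Ico 0 s, f (v t) - A * B * v t ≤ 0 := fun t ht => by
    have := hf.lt (v t) (hpos t ht).1
      ((hanti (left_mem_Icc.2 hs.le) (Ico_subset_Icc_self ht) ht.1).trans_lt hv0)
    linarith
  have hconc' : ∀ t ∈ Ico 0 s, q t - A * w t ≤ 0 := by
    intro t ht
    have := le_of_hasDerivAt_nonneg ht.1 (fun u _ => (hred u).fun_neg)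
      (fun u hu => by linarith [hconc u ⟨hu.1, hu.2.trans_lt ht.2⟩])
    beta_reduce at this
    rw [hw, hq] at this
    linarith
  have hrs := antitoneOn_of_hasDerivWithinAt_nonpos (convex_Icc 0 s)
    (fun t _ => (hr t).continuousAt.continuousWithinAt) (fun t _ => (hr t).hasDerivWithinAt)
    (fun t ht => by
      rw [interior_Icc] at ht
      exact hconc' t ⟨ht.1.le, ht.2⟩) (left_mem_Icc.2 hs.le) (right_mem_Icc.2 hs.le) hs.le
  beta_reduce at hrs
  rw [hvs, hys] at hrs
  have h0 := hpos 0 ⟨le_rfl, hs⟩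
  have := mul_pos hA h0.1
  linarith

/-- Alternative for even trajectories starting below the equilibrium: either they remain in the
region `v > 0 > y`, or they leave it through exactly one of its two faces. -/
lemma exit_alternative (hA : 0 < A) (hB : 0 ≤ B) (hf : IsCrossingSource K (A * B) m f)
    (h : IsTrajectory A B f v w y q) (hpos : 0 < v 0) (hv0 : v 0 < m) (hw : w 0 = 0)
    (hq : q 0 = 0) :
    (∀ t, 0 ≤ t → 0 < v t ∧ y t < 0) ∨
      (∃ t, 0 ≤ t ∧ -y t < 0 ∧ ∀ s ∈ Icc 0 t, 0 < v s) ∨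
      ∃ t, 0 ≤ t ∧ v t < 0 ∧ ∀ s ∈ Icc 0 t, 0 < -y s := by
  have hev := even hA.le hB hf.monotone hf.lipschitz h hw hq
  -- Touching the face `y = 0` implies crossing it: there `y'' = f(v) > 0`, so `y` has no local
  -- maximum. When `s = 0`, evenness supplies the neighbourhood to the left.
  have htop : ∀ s, 0 ≤ s → y s = 0 → (∀ t ∈ Icc 0 s, 0 < v t) → (∀ t ∈ Ico 0 s, y t < 0) →
      ∃ t, 0 ≤ t ∧ -y t < 0 ∧ ∀ s ∈ Icc 0 t, 0 < v s := by
    intro s hs hys hvs hyneg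
    by_contra! hcon
    have hmaxpos : ∀ᶠ t in 𝓝 s, 0 ≤ t → y t ≤ 0 := by
      have h1 : ∀ᶠ t in 𝓝 s, 0 < v t :=
        h.continuous_v.continuousAt.eventually_const_lt (hvs s (right_mem_Icc.2 hs))
      obtain ⟨ε, hε, h2⟩ := Metric.eventually_nhds_iff.1 h1
      refine Metric.eventually_nhds_iff.2 ⟨ε, hε, fun t ht ht0 => ?_⟩
      rcases lt_or_ge t s with hts | hts
      · exact (hyneg t ⟨ht0, hts⟩).le
      · by_contra! hyt
        obtain ⟨u, hu, hvu⟩ := hcon t ht0 (by linarith)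
        rcases le_or_gt u s with hus | hus
        · exact absurd (hvs u ⟨hu.1, hus⟩) (not_lt.2 hvu)
        · refine absurd (h2 ?_) (not_lt.2 hvu)
          rw [Real.dist_eq, abs_of_pos (by linarith)]
          rw [Real.dist_eq, abs_of_nonneg (by linarith)] at ht
          linarith [hu.2]
    have hmax : IsLocalMax y s := by
      rcases hs.eq_or_lt with rfl | hs
      · have h2 : ∀ᶠ t in 𝓝 (0 : ℝ), 0 ≤ -t → y (-t) ≤ 0 :=
          (continuous_neg.tendsto' (0 : ℝ) 0 neg_zero).eventually hmaxpos
        filter_upwards [hmaxpos, h2] with t h3 h4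
        rw [hys]
        rcases le_total 0 t with h5 | h5
        · exact h3 h5
        · rw [← (hev t).2]; exact h4 (by linarith)
      · filter_upwards [hmaxpos, lt_mem_nhds hs] with t h3 h4
        rw [hys]
        exact h3 h4.le
    refine not_isLocalMax_of_deriv_deriv_pos h.hasDerivAt_y (h.hasDerivAt_q s) ?_ hmax
    rw [hys, mul_zero, zero_add]
    exact hf.pos _ (hvs s (right_mem_Icc.2 hs))
  rcases lt_trichotomy (y 0) 0 with hy0 | hy0 | hy0
  · by_cases hall : ∀ t, 0 ≤ t → 0 < v t ∧ y t < 0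
    · exact Or.inl hall
    right
    push Not at hall
    obtain ⟨t, ht, ht'⟩ := hall
    obtain ⟨s, hs, hs0, hspos⟩ := exists_first_zero (f := fun t => min (v t) (-y t)) ht
      (h.continuous_v.min h.continuous_y.neg).continuousOn (lt_min hpos (by linarith))
      (by
        rcases lt_or_ge 0 (v t) with h1 | h1
        · exact min_le_of_right_le (by linarith [ht' h1])
        · exact min_le_of_left_le h1)
    have hreg : ∀ t ∈ Ico 0 s, 0 < v t ∧ y t < 0 := fun t ht => by
      have := lt_min_iff.1 (hspos t ht)
      exact ⟨this.1, by linarith⟩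
    have hvs0 : 0 ≤ v s := hs0.symm.le.trans (min_le_left _ _)
    have hys0 : 0 ≤ -y s := hs0.symm.le.trans (min_le_right _ _)
    rcases hvs0.eq_or_lt with hvs | hvs
    · rcases hys0.eq_or_lt with hys | hys
      · exact (not_corner hA hB hf h hv0 hw hq hs.1 hreg hvs.symm (by linarith)).elim
      -- On the face `v = 0` one has `v'' = y < 0`, so `v` cannot have a local minimum there and
      -- must become negative.
      · right
        by_contra! hcon
        have hmin : IsLocalMax (fun t => -v t) s := by
          have h1 : ∀ᶠ t in 𝓝 s, y t < 0 :=
            h.continuous_y.continuousAt.eventually_lt_const (by linarith)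
          obtain ⟨ε, hε, h2⟩ := Metric.eventually_nhds_iff.1 h1
          have h3 : ∀ᶠ t in 𝓝 s, dist t s < ε := Metric.ball_mem_nhds s hε
          filter_upwards [h3, lt_mem_nhds hs.1] with t h4 h5
          rw [← hvs, neg_zero, neg_nonpos]
          rcases lt_or_ge t s with hts | hts
          · exact (hreg t ⟨h5.le, hts⟩).1.le
          · by_contra! hvt
            obtain ⟨u, hu, hyu⟩ := hcon t h5.le hvt
            rcases lt_or_ge u s with hus | hus
            · linarith [(hreg u ⟨hu.1, hus⟩).2]
            · have : y u < 0 := h2 (by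
                rw [Real.dist_eq, abs_of_nonneg (by linarith)]
                rw [Real.dist_eq, abs_of_nonneg (by linarith)] at h4
                linarith [hu.2])
              linarith
        refine not_isLocalMax_of_deriv_deriv_pos (fun t => (h.hasDerivAt_v t).fun_neg)
          (h.hasDerivAt_w s).fun_neg ?_ hmin
        rw [← hvs]
        linarith
    · left
      have hys : y s = 0 := by
        rcases min_choice (v s) (-y s) with h1 | h1
        · exact absurd (h1.symm.trans hs0) hvs.ne'
        · linarith [h1.symm.trans hs0]
      refine htop s hs.1.le hys (fun t ht => ?_) (fun t ht => (hreg t ht).2)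
      rcases ht.2.lt_or_eq with h1 | rfl
      · exact (hreg t ⟨ht.1, h1⟩).1
      · exact hvs
  · right; left
    refine htop 0 le_rfl hy0 (fun t ht => ?_) (fun t ht => absurd ht.2 (not_lt.2 ht.1))
    rw [le_antisymm ht.2 ht.1]
    exact hpos
  · right; left
    refine ⟨0, le_rfl, by linarith, fun t ht => ?_⟩
    rw [le_antisymm ht.2 ht.1]
    exact hpos

end IsTrajectory

/-- Through every value below the equilibrium there is an even positive trajectory with
`v'' ≤ B v`. -/
theorem exists_positive_isTrajectory {A B m a : ℝ} {K : NNReal} {f : ℝ → ℝ} (hA : 0 < A)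
    (hB : 0 < B) (hfd : ContDiff ℝ 1 f) (hf : IsCrossingSource K (A * B) m f) (ha : 0 < a)
    (ham : a < m) : ∃ v w y q, IsTrajectory A B f v w y q ∧ v 0 = a ∧ w 0 = 0 ∧ q 0 = 0 ∧
      (∀ t, 0 < v t) ∧ ∀ t, y t ≤ 0 := by
  choose V W Y Q htraj hV hW hY hQ using exists_isTrajectory A B hfd hf.lipschitz a
  by_cases hgood : ∃ η, ∀ t, 0 ≤ t → 0 < V η t ∧ Y η t < 0
  · obtain ⟨η, hη⟩ := hgood
    have hev := (htraj η).even hA.le hB.le hf.monotone hf.lipschitz (hW η) (hQ η)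
    have habs : ∀ t, 0 < V η t ∧ Y η t < 0 := fun t => by
      rcases le_total 0 t with ht | ht
      · exact hη t ht
      · rw [← (hev t).1, ← (hev t).2]
        exact hη (-t) (by linarith)
    exact ⟨V η, W η, Y η, Q η, htraj η, hV η, hW η, hQ η, fun t => (habs t).1,
      fun t => (habs t).2.le⟩
  exfalso
  push Not at hgood
  obtain ⟨L, hL, hdist⟩ := exists_dist_le_of_isTrajectory A B hf.lipschitz
  have hd : ∀ η η' t, 0 ≤ t → |V η t - V η' t| ≤ |η - η'| * Real.exp (L * t) ∧
      |Y η t - Y η' t| ≤ |η - η'| * Real.exp (L * t) := fun η η' t ht => by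
    have := hdist _ _ _ _ _ _ _ _ (htraj η) (htraj η') (by rw [hV, hV]) (by rw [hW, hW])
      (by rw [hQ, hQ]) t ht
    rwa [hY, hY] at this
  have hdY : ∀ η η' t, 0 ≤ t → |(-Y η t) - (-Y η' t)| ≤ |η - η'| * Real.exp (L * t) :=
    fun η η' t ht => by
      rw [neg_sub_neg, abs_sub_comm]
      exact (hd η η' t ht).2
  have hup := isOpen_setOf_exit (g := fun η t => -Y η t) (h := V) hL
    (fun η => (htraj η).continuous_v) hdY (fun η η' t ht => (hd η η' t ht).1)
  have hdown := isOpen_setOf_exit (g := V) (h := fun η t => -Y η t) hL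
    (fun η => (htraj η).continuous_y.neg) (fun η η' t ht => (hd η η' t ht).1) hdY
  have hm : 0 < m := ha.trans ham
  have hBm : 0 < B * m := mul_pos hB hm
  have halt : ∀ η, (∃ t, 0 ≤ t ∧ -Y η t < 0 ∧ ∀ s ∈ Icc 0 t, 0 < V η s) ∨
      ∃ t, 0 ≤ t ∧ V η t < 0 ∧ ∀ s ∈ Icc 0 t, 0 < -Y η s := by
    intro η
    refine ((htraj η).exit_alternative hA hB.le hf (by rw [hV]; exact ha) (by rw [hV]; exact ham)
      (hW η) (hQ η)).resolve_left fun hη => ?_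
    obtain ⟨t, ht, ht'⟩ := hgood η
    exact absurd (hη t ht).2 (not_lt.2 (ht' (hη t ht).1))
  have hconst : IsTrajectory A B f (fun _ => m) (fun _ => 0) (fun _ => -(B * m)) fun _ => 0 := by
    refine ⟨fun t => hasDerivAt_const _ _, fun t => ?_, fun t => hasDerivAt_const _ _, fun t => ?_⟩
    · exact (hasDerivAt_const t _).congr_deriv (by ring)
    · exact (hasDerivAt_const t _).congr_deriv (by rw [hf.eq]; ring)
  -- For `η = -B m` the constant trajectory `m` dominates, which keeps `y ≤ -B m` and rules out the
  -- exit through `y = 0`.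
  have hlow : ∀ t, 0 ≤ t → Y (-(B * m)) t < 0 := by
    intro t ht
    have := IsTrajectory.sub_le_sub hA.le hB.le hf.monotone hf.lipschitz hconst
      (htraj (-(B * m))) (t₀ := 0) (by rw [hV]; exact ham.le) (by rw [hW]) (by rw [hY])
      (by rw [hQ]) t ht
    have := this.2.2.1
    rw [hY] at this
    linarith
  obtain ⟨η, -, ⟨t₁, ht₁, h1, h2⟩, ⟨t₂, ht₂, h3, h4⟩⟩ :=
    (isPreconnected_univ (α := ℝ)) _ _ hup hdown (fun η _ => halt η)
      ⟨1, mem_univ _, 0, le_rfl, by rw [hY]; norm_num, fun s hs => by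
        rw [le_antisymm hs.2 hs.1, hV]; exact ha⟩
      ⟨-(B * m), mem_univ _, (halt (-(B * m))).resolve_left fun ⟨t, ht, h1, _⟩ => by
        linarith [hlow t ht]⟩
  -- The exits exclude each other: the one that happens later requires the opposite sign at the
  -- earlier exit time.
  rcases le_total t₁ t₂ with h | h
  · linarith [h4 t₁ ⟨ht₁, h⟩]
  · linarith [h2 t₂ ⟨ht₂, h⟩]

/-! ### The fourth order equation -/

lemma IsODESolution.isTrajectory {A B K2 K0 p : ℝ} {v : ℝ → ℝ} (h2 : K2 = A + B) (h0 : K0 = A * B)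
    (h : IsODESolution K2 K0 p v) :
    IsTrajectory A B (fun x => x ^ p) v (deriv v) (fun t => iteratedDeriv 2 v t - B * v t)
      (fun t => iteratedDeriv 3 v t - B * deriv v t) := by
  have hd : ∀ k : ℕ, k < 4 → ∀ t, HasDerivAt (iteratedDeriv k v) (iteratedDeriv (k + 1) v t) t := by
    intro k hk t
    have h3 := h.1.differentiable_iteratedDeriv k (by exact_mod_cast hk) t
    rw [iteratedDeriv_succ]
    exact h3.hasDerivAt
  have hd0 := hd 0 (by norm_num)
  have hd1 := hd 1 (by norm_num)
  simp only [iteratedDeriv_zero, zero_add, iteratedDeriv_one, Nat.reduceAdd] at hd0 hd1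
  refine ⟨hd0, fun t => (hd1 t).congr_deriv (by ring),
    fun t => (hd 2 (by norm_num) t).sub ((hd0 t).const_mul B), fun t => ?_⟩
  refine ((hd 3 (by norm_num) t).sub ((hd1 t).const_mul B)).congr_deriv ?_
  have := h.2 t
  rw [h2, h0] at this
  norm_num
  linarith

namespace IsTrajectory

variable {A B p a : ℝ} {v w y q : ℝ → ℝ}

lemma isODESolution {K2 K0 : ℝ} (h2 : K2 = A + B) (h0 : K0 = A * B) (hp : 0 ≤ p)
    (h : IsTrajectory A B (fun x => x ^ p) v w y q) :
    IsODESolution K2 K0 p v := by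
  have h1 : iteratedDeriv 1 v = w := by
    rw [iteratedDeriv_one]; exact funext fun t => (h.hasDerivAt_v t).deriv
  have h2' : iteratedDeriv 2 v = fun t => B * v t + y t := by
    rw [iteratedDeriv_succ, h1]; exact funext fun t => (h.hasDerivAt_w t).deriv
  have hd3 : ∀ t, HasDerivAt (fun t => B * v t + y t) (B * w t + q t) t := fun t =>
    ((h.hasDerivAt_v t).const_mul B).add (h.hasDerivAt_y t)
  have h3 : iteratedDeriv 3 v = fun t => B * w t + q t := by
    rw [iteratedDeriv_succ, h2']; exact funext fun t => (hd3 t).deriv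
  have hd4 : ∀ t, HasDerivAt (fun t => B * w t + q t)
      (B * (B * v t + y t) + (A * y t + v t ^ p)) t := fun t =>
    ((h.hasDerivAt_w t).const_mul B).add (h.hasDerivAt_q t)
  have h4 : iteratedDeriv 4 v = fun t => B * (B * v t + y t) + (A * y t + v t ^ p) := by
    rw [iteratedDeriv_succ, h3]; exact funext fun t => (hd4 t).deriv
  have hv := h.continuous_v
  have hw := h.continuous_w
  have hy := h.continuous_y
  have hq : Continuous q := continuous_iff_continuousAt.2 fun t => (h.hasDerivAt_q t).continuousAt
  have hvp : Continuous fun t => v t ^ p := hv.rpow_const fun _ => Or.inr hp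
  refine ⟨?_, fun t => ?_⟩
  · have : ContDiff ℝ ((4 : ℕ) : ℕ∞) v := by
      refine contDiff_nat_iff_iteratedDeriv.2 ⟨fun k hk => ?_, fun k hk => ?_⟩
      · interval_cases k
        · rwa [iteratedDeriv_zero]
        · rwa [h1]
        · rw [h2']; fun_prop
        · rw [h3]; fun_prop
        · rw [h4]; fun_prop
      · interval_cases k
        · rw [iteratedDeriv_zero]; exact fun t => (h.hasDerivAt_v t).differentiableAt
        · rw [h1]; exact fun t => (h.hasDerivAt_w t).differentiableAt
        · rw [h2']; exact fun t => (hd3 t).differentiableAt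
        · rw [h3]; exact fun t => (hd4 t).differentiableAt
    exact_mod_cast this
  · rw [h4, h2', h2, h0]
    ring

lemma congr_truncPow (hp : 1 < p) {M : ℝ} (h : IsTrajectory A B (fun x => x ^ p) v w y q)
    (h0 : ∀ t, 0 ≤ v t) (hM : ∀ t, v t ≤ M) : IsTrajectory A B (truncPow p M) v w y q :=
  h.congr_source fun t => (truncPow_eq_rpow hp (h0 t) (hM t)).symm

end IsTrajectory

lemma IsPeriodic.exists_forall_le {v : ℝ → ℝ} (h : IsPeriodic v) (hv : Continuous v) :
    ∃ M, ∀ t, v t ≤ M := by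
  obtain ⟨T, hT, hper⟩ := h
  obtain ⟨M, hM⟩ := (hper.compact_of_continuous hT.ne' hv).bddAbove
  exact ⟨M, fun t => hM ⟨t, rfl⟩⟩

/-- Existence and uniqueness up to translation of the periodic solution with given minimum. -/
theorem exists_unique_isPeriodic {A B p a : ℝ} (hA : 0 < A) (hB : 0 < B) (hp : 1 < p) (ha : 0 < a)
    (ham : a < (A * B) ^ (1 / (p - 1))) :
    ∃ v : ℝ → ℝ, (IsODESolution (A + B) (A * B) p v ∧ IsPeriodic v ∧ IsLeast (range v) a) ∧
      ∀ u : ℝ → ℝ, IsODESolution (A + B) (A * B) p u → IsPeriodic u → IsLeast (range u) a →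
        ∃ τ : ℝ, ∀ t, u t = v (t + τ) := by
  have hp1 : 0 < p - 1 := by linarith
  set m := (A * B) ^ (1 / (p - 1)) with hm
  have hm0 : 0 < m := ha.trans ham
  have hκ : m ^ (p - 1) = A * B := by
    rw [hm, ← Real.rpow_mul (mul_pos hA hB).le, one_div_mul_cancel hp1.ne', Real.rpow_one]
  set R := aprioriBound A B p with hR
  set M := max m R + 1 with hMdef
  have hmM : m < M := by linarith [le_max_left m R]
  have hRM : R < M := by linarith [le_max_right m R]
  have hM0 : 0 < M := hm0.trans hmM
  have hf := isCrossingSource_truncPow hp hm0 hκ hmM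
  obtain ⟨v, w, y, q, htraj, hv0, hw0, hq0, hpos, hy⟩ :=
    exists_positive_isTrajectory hA hB (contDiff_truncPow hp) hf ha ham
  have hvR : ∀ t, v t ≤ R := htraj.le_aprioriBound hA.le hB.le hp hpos hy
    (fun t => (hf.pos _ (hpos t)).le) (hf.monotone.monotoneOn _) hRM
    (fun x hx => mul_min_rpow_le_truncPow hp hM0.le hx)
  obtain ⟨hper, hmin⟩ := htraj.isPeriodic_of_critical_lt hA.le hB.le hf hvR hpos
    (by rw [hv0]; exact ham) hw0 hq0
  have htraj' : IsTrajectory A B (fun x => x ^ p) v w y q := htraj.congr_source fun t =>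
    truncPow_eq_rpow hp (hpos t).le ((hvR t).trans hRM.le)
  refine ⟨v, ⟨htraj'.isODESolution rfl rfl (by linarith), hper, ⟨0, hv0⟩, ?_⟩, ?_⟩
  · rintro _ ⟨t, rfl⟩
    rw [← hv0]
    exact hmin t
  · rintro u hu huper ⟨⟨s, hs⟩, hleast⟩
    have hut := hu.isTrajectory rfl rfl
    obtain ⟨Mu, hMu⟩ := huper.exists_forall_le hut.continuous_v
    have hau : ∀ t, a ≤ u t := fun t => hleast ⟨t, rfl⟩
    have hus : deriv u s = 0 := by
      refine IsLocalMin.deriv_eq_zero (Eventually.of_forall fun t => ?_)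
      rw [hs]
      exact hau t
    -- A common truncation level for `u` and `v`. Both solutions have value `a` and zero slope at
    -- their minima, so after translation they agree.
    set N := max R Mu with hN
    have hN0 : 0 ≤ N := ((hpos 0).le.trans (hvR 0)).trans (le_max_left _ _)
    have hvN : ∀ t, v t ≤ N := fun t => (hvR t).trans (le_max_left _ _)
    have huN : ∀ t, u t ≤ N := fun t => (hMu t).trans (le_max_right _ _)
    have hu0 : ∀ t, 0 ≤ u t := fun t => ha.le.trans (hau t)
    have key := IsTrajectory.eq_of_bounded hA.le hB.le (monotone_truncPow hp hN0)
      (lipschitzWith_truncPow hp hN0) ((hut.congr_truncPow hp hu0 huN).shift s)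
      (htraj'.congr_truncPow hp (fun t => (hpos t).le) hvN) (t₀ := 0) (fun t => huN _)
      (fun t => hu0 _) hvN (fun t => (hpos t).le) (by simp [hs, hv0]) (by simp [hus, hw0])
    refine ⟨-s, fun t => ?_⟩
    have := (key (t + -s)).1
    simpa using this

/-! ### Radial functions in Emden–Fowler coordinates -/

section Radial

variable {n : ℕ}

/-- The radial function `|x|^s w(-log |x|)`. -/
noncomputable def emdenFowler (n : ℕ) (s : ℝ) (w : ℝ → ℝ) (x : EuclideanSpace ℝ (Fin n)) : ℝ :=
  ‖x‖ ^ s * w (-Real.log ‖x‖)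

lemma hasFDerivAt_norm_of_ne_zero {E : Type*} [NormedAddCommGroup E] [InnerProductSpace ℝ E] {x : E}
    (hx : x ≠ 0) : HasFDerivAt (fun y : E => ‖y‖) (‖x‖⁻¹ • innerSL ℝ x) x := by
  have h1 := ((hasStrictFDerivAt_norm_sq x).hasFDerivAt).sqrt (pow_ne_zero 2 (norm_ne_zero_iff.2 hx))
  simp only [Real.sqrt_sq (norm_nonneg _)] at h1
  refine h1.congr_fderiv ?_
  ext z
  simp
  field_simp

lemma hasFDerivAt_emdenFowler {s w' : ℝ} {w : ℝ → ℝ} {x : EuclideanSpace ℝ (Fin n)} (hx : x ≠ 0)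
    (hw : HasDerivAt w w' (-Real.log ‖x‖)) :
    HasFDerivAt (emdenFowler n s w)
      ((‖x‖ ^ (s - 2) * (s * w (-Real.log ‖x‖) - w')) • innerSL ℝ x) x := by
  have hr : 0 < ‖x‖ := norm_pos_iff.2 hx
  have h1 : HasDerivAt (fun r : ℝ => r ^ s * w (-Real.log r))
      (s * ‖x‖ ^ (s - 1) * w (-Real.log ‖x‖) + ‖x‖ ^ s * (w' * -‖x‖⁻¹)) ‖x‖ :=
    (Real.hasDerivAt_rpow_const (Or.inl hr.ne')).mul
      (HasDerivAt.comp ‖x‖ (h := fun r : ℝ => -Real.log r) hw (Real.hasDerivAt_log hr.ne').neg)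
  have h2 : HasFDerivAt (fun y : EuclideanSpace ℝ (Fin n) => ‖y‖ ^ s * w (-Real.log ‖y‖)) _ x :=
    h1.comp_hasFDerivAt x (hasFDerivAt_norm_of_ne_zero hx)
  refine h2.congr_fderiv ?_
  rw [smul_smul]
  congr 1
  have e1 : ‖x‖ ^ (s - 1) = ‖x‖ ^ (s - 2) * ‖x‖ := by
    rw [← Real.rpow_add_one hr.ne']; congr 1; ring
  have e2 : ‖x‖ ^ s = ‖x‖ ^ (s - 2) * ‖x‖ * ‖x‖ := by
    rw [← e1, ← Real.rpow_add_one hr.ne']; congr 1; ring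
  rw [e2, e1]
  field_simp
  ring

lemma gradient_emdenFowler {s w' : ℝ} {w : ℝ → ℝ} {x : EuclideanSpace ℝ (Fin n)} (hx : x ≠ 0)
    (hw : HasDerivAt w w' (-Real.log ‖x‖)) :
    gradient (emdenFowler n s w) x = (‖x‖ ^ (s - 2) * (s * w (-Real.log ‖x‖) - w')) • x := by
  refine HasGradientAt.gradient ?_
  rw [hasGradientAt_iff_hasFDerivAt]
  refine (hasFDerivAt_emdenFowler hx hw).congr_fderiv ?_
  ext z
  simp

lemma hasFDerivAt_emdenFowler_smul {s w' : ℝ} {w : ℝ → ℝ} {x : EuclideanSpace ℝ (Fin n)}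
    (hx : x ≠ 0) (hw : HasDerivAt w w' (-Real.log ‖x‖)) :
    HasFDerivAt (fun y => emdenFowler n s w y • y)
      (emdenFowler n s w x • ContinuousLinearMap.id ℝ _ +
        (((‖x‖ ^ (s - 2) * (s * w (-Real.log ‖x‖) - w')) • innerSL ℝ x).smulRight x)) x :=
  (hasFDerivAt_emdenFowler hx hw).smul (hasFDerivAt_id x)

lemma divergence_emdenFowler_smul {s w' : ℝ} {w : ℝ → ℝ} {x : EuclideanSpace ℝ (Fin n)}
    (hx : x ≠ 0) (hw : HasDerivAt w w' (-Real.log ‖x‖)) :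
    divergence (fun y => emdenFowler n s w y • y) x =
      ‖x‖ ^ s * ((n + s) * w (-Real.log ‖x‖) - w') := by
  have hr : 0 < ‖x‖ := norm_pos_iff.2 hx
  have e2 : ‖x‖ ^ s = ‖x‖ ^ (s - 2) * ‖x‖ ^ 2 := by
    rw [← Real.rpow_natCast, ← Real.rpow_add hr]; congr 1; push_cast; ring
  have hn : ∑ i, x i * x i = ‖x‖ ^ 2 := by
    rw [EuclideanSpace.norm_sq_eq]
    exact Finset.sum_congr rfl fun i _ => by rw [Real.norm_eq_abs, sq_abs, sq]
  rw [divergence, (hasFDerivAt_emdenFowler_smul hx hw).fderiv]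
  set c := ‖x‖ ^ (s - 2) * (s * w (-Real.log ‖x‖) - w') with hc
  have : ∀ i : Fin n, ((emdenFowler n s w x • ContinuousLinearMap.id ℝ (EuclideanSpace ℝ (Fin n)) +
      ((c • innerSL ℝ x).smulRight x)) (EuclideanSpace.single i 1)) i
      = emdenFowler n s w x + c * (x i * x i) := by
    intro i
    simp [EuclideanSpace.inner_single_right]
    ring
  simp only [this]
  rw [Finset.sum_add_distrib, ← Finset.mul_sum, hn, Finset.sum_const, Finset.card_univ,
    Fintype.card_fin, nsmul_eq_mul, emdenFowler, hc, e2]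
  ring

/-- The derivative of `f` is dual to `G` near `x`, so the trace of the second derivative of `f` is
the trace of the derivative of `G`. -/
lemma laplacian_eq_divergence {f : EuclideanSpace ℝ (Fin n) → ℝ}
    {G : EuclideanSpace ℝ (Fin n) → EuclideanSpace ℝ (Fin n)} {x : EuclideanSpace ℝ (Fin n)}
    (hf : ∀ᶠ y in 𝓝 x, HasFDerivAt f (innerSL ℝ (G y)) y) (hG : DifferentiableAt ℝ G x) :
    Laplacian.laplacian f x = divergence G x := by
  rw [InnerProductSpace.laplacian_eq_iteratedFDeriv_orthonormalBasis f
    (EuclideanSpace.basisFun (Fin n) ℝ), divergence]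
  refine Finset.sum_congr rfl fun i _ => ?_
  have h1 : fderiv ℝ f =ᶠ[𝓝 x] fun y => innerSL ℝ (G y) := by
    filter_upwards [hf] with y hy using hy.fderiv
  have h2 : HasFDerivAt (fun y => innerSL ℝ (G y)) ((innerSL ℝ).comp (fderiv ℝ G x)) x :=
    (innerSL ℝ).hasFDerivAt.comp x hG.hasFDerivAt
  rw [iteratedFDeriv_two_apply, h1.fderiv_eq, h2.fderiv]
  simp [EuclideanSpace.inner_single_right]

lemma laplacian_emdenFowler {s : ℝ} {w w₁ w₂ : ℝ → ℝ} (hw : ∀ t, HasDerivAt w (w₁ t) t)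
    (hw₁ : ∀ t, HasDerivAt w₁ (w₂ t) t) {x : EuclideanSpace ℝ (Fin n)} (hx : x ≠ 0) :
    Laplacian.laplacian (emdenFowler n s w) x =
      emdenFowler n (s - 2)
        (fun t => w₂ t - (2 * s + n - 2) * w₁ t + s * (s + n - 2) * w t) x := by
  have hz : ∀ t, HasDerivAt (fun t => s * w t - w₁ t) (s * w₁ t - w₂ t) t := fun t =>
    ((hw t).const_mul s).sub (hw₁ t)
  rw [laplacian_eq_divergence (G := fun y => emdenFowler n (s - 2) (fun t => s * w t - w₁ t) y • y),
    divergence_emdenFowler_smul hx (hz _), emdenFowler]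
  · ring
  · filter_upwards [isOpen_compl_singleton.mem_nhds hx] with y hy
    refine (hasFDerivAt_emdenFowler hy (hw _)).congr_fderiv ?_
    rw [map_smul, emdenFowler]
  · exact (hasFDerivAt_emdenFowler_smul hx (hz _)).differentiableAt

lemma rpow_mul_emdenFowler {s r : ℝ} {w : ℝ → ℝ} {x : EuclideanSpace ℝ (Fin n)} (hx : x ≠ 0) :
    ‖x‖ ^ r * emdenFowler n s w x = emdenFowler n (s + r) w x := by
  rw [emdenFowler, emdenFowler, add_comm, Real.rpow_add (norm_pos_iff.2 hx), mul_assoc]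

end Radial

/-! ### Reduction to the line, factorization, and proof of the theorem -/

/-- The Emden–Fowler transform turns positive radial solutions into positive solutions of the
fourth order equation on the line. -/
lemma IsPositiveRadialSolution.exists_isODESolution {n : ℕ} (hn : 0 < n) {α β p lam μ : ℝ}
    (hp : 1 < p) (hcrit : ((n : ℝ) + α) / 2 + ((n : ℝ) + β) / (p + 1) = (n : ℝ) - 2)
    {u : EuclideanSpace ℝ (Fin n) → ℝ} (hu : IsPositiveRadialSolution α β p lam μ u) :
    ∃ v : ℝ → ℝ, IsEmdenFowlerTransform α u v ∧ (∀ t, 0 < v t) ∧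
      IsODESolution (coeffK2 n α lam) (coeffK0 n α lam μ) p v := by
  set γ : ℝ := ((n : ℝ) - 4 - α) / 2 with hγ
  -- Any unit vector would do, as `u` is radial.
  set e : EuclideanSpace ℝ (Fin n) := EuclideanSpace.single ⟨0, hn⟩ 1 with he
  have hnorm : ∀ t : ℝ, ‖Real.exp (-t) • e‖ = Real.exp (-t) := fun t => by
    rw [norm_smul, he, EuclideanSpace.single, PiLp.norm_single, norm_one, mul_one, Real.norm_eq_abs, Real.abs_exp]
  have hne : ∀ t : ℝ, Real.exp (-t) • e ≠ 0 := fun t => by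
    rw [← norm_ne_zero_iff, hnorm]
    exact (Real.exp_pos _).ne'
  set v : ℝ → ℝ := fun t => Real.exp (-(γ * t)) * u (Real.exp (-t) • e) with hv
  have hEF : IsEmdenFowlerTransform α u v := by
    intro x hx
    have hr : 0 < ‖x‖ := norm_pos_iff.2 hx
    have h1 : u (Real.exp (- -Real.log ‖x‖) • e) = u x := by
      refine hu.radial _ _ ?_
      rw [hnorm, neg_neg, Real.exp_log hr]
    rw [hv]
    beta_reduce
    rw [h1, Real.rpow_def_of_pos hr, ← hγ]
    congr 2
    ring
  have hvpos : ∀ t, 0 < v t := fun t => mul_pos (Real.exp_pos _) (hu.pos _ (hne t))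
  have hvC : ContDiff ℝ 4 v := by
    have h1 : ContDiff ℝ 4 fun t : ℝ => Real.exp (-t) • e := by fun_prop
    have h2 : ContDiff ℝ 4 fun t : ℝ => u (Real.exp (-t) • e) :=
      hu.contDiffOn.comp_contDiff h1 (fun t => hne t)
    have h3 : ContDiff ℝ 4 fun t : ℝ => Real.exp (-(γ * t)) := by fun_prop
    exact h3.mul h2
  have hd : ∀ k : ℕ, k < 4 → ∀ t, HasDerivAt (iteratedDeriv k v) (iteratedDeriv (k + 1) v t) t := by
    intro k hk t
    have h3 := hvC.differentiable_iteratedDeriv k (by exact_mod_cast hk) t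
    rw [iteratedDeriv_succ]
    exact h3.hasDerivAt
  have hd0 : ∀ t, HasDerivAt v (iteratedDeriv 1 v t) t := by simpa using hd 0 (by norm_num)
  have hd1 := hd 1 (by norm_num)
  have hd2 := hd 2 (by norm_num)
  have hd3 := hd 3 (by norm_num)
  simp only [Nat.reduceAdd] at hd1 hd2 hd3
  have hu_eq : ∀ x, x ≠ 0 → u x = emdenFowler n (-γ) v x := by
    intro x hx
    rw [emdenFowler, hEF x hx, ← mul_assoc, ← Real.rpow_add (norm_pos_iff.2 hx), ← hγ,
      neg_add_cancel, Real.rpow_zero, one_mul]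
  have hgerm : ∀ x, x ≠ 0 → u =ᶠ[𝓝 x] emdenFowler n (-γ) v := fun x hx => by
    filter_upwards [isOpen_compl_singleton.mem_nhds hx] with y hy using hu_eq y hy
  set D := fun k => iteratedDeriv k v with hD
  set W := fun t => D 2 t - (2 * -γ + n - 2) * D 1 t + -γ * (-γ + n - 2) * v t with hW
  set W₁ := fun t => D 3 t - (2 * -γ + n - 2) * D 2 t + -γ * (-γ + n - 2) * D 1 t with hW₁
  set W₂ := fun t => D 4 t - (2 * -γ + n - 2) * D 3 t + -γ * (-γ + n - 2) * D 2 t with hW₂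
  have hWd : ∀ t, HasDerivAt W (W₁ t) t := fun t =>
    ((hd2 t).sub ((hd1 t).const_mul _)).add ((hd0 t).const_mul _)
  have hW₁d : ∀ t, HasDerivAt W₁ (W₂ t) t := fun t =>
    ((hd3 t).sub ((hd2 t).const_mul _)).add ((hd1 t).const_mul _)
  have hlap : ∀ x, x ≠ 0 → Laplacian.laplacian u x = emdenFowler n (-γ - 2) W x := fun x hx => by
    rw [(InnerProductSpace.laplacian_congr_nhds (hgerm x hx)).eq_of_nhds,
      laplacian_emdenFowler hd0 hd1 hx]
  have hbilap : ∀ x, x ≠ 0 →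
      Laplacian.laplacian (fun y => ‖y‖ ^ (-α) * Laplacian.laplacian u y) x =
        emdenFowler n (-γ - 2 + -α - 2) (fun t => W₂ t - (2 * (-γ - 2 + -α) + n - 2) * W₁ t +
          (-γ - 2 + -α) * ((-γ - 2 + -α) + n - 2) * W t) x := fun x hx => by
    have h1 : (fun y => ‖y‖ ^ (-α) * Laplacian.laplacian u y) =ᶠ[𝓝 x]
        emdenFowler n (-γ - 2 + -α) W := by
      filter_upwards [isOpen_compl_singleton.mem_nhds hx] with y hy
      rw [hlap y hy, rpow_mul_emdenFowler hy]
    rw [(InnerProductSpace.laplacian_congr_nhds h1).eq_of_nhds, laplacian_emdenFowler hWd hW₁d hx]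
  set Z := fun t => -γ * v t - D 1 t with hZ
  have hZd : ∀ t, HasDerivAt Z (-γ * D 1 t - D 2 t) t := fun t =>
    ((hd0 t).const_mul _).sub (hd1 t)
  have hdiv : ∀ x, x ≠ 0 → divergence (fun y => ‖y‖ ^ (-α - 2) • gradient u y) x =
      ‖x‖ ^ (-γ - 2 + (-α - 2)) * ((n + (-γ - 2 + (-α - 2))) * Z (-Real.log ‖x‖) -
        (-γ * D 1 (-Real.log ‖x‖) - D 2 (-Real.log ‖x‖))) := fun x hx => by
    have h1 : (fun y => ‖y‖ ^ (-α - 2) • gradient u y) =ᶠ[𝓝 x]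
        fun y => emdenFowler n (-γ - 2 + (-α - 2)) Z y • y := by
      filter_upwards [isOpen_compl_singleton.mem_nhds hx] with y hy
      have h2 : gradient u y = gradient (emdenFowler n (-γ) v) y := by
        rw [gradient, gradient, (hgerm y hy).fderiv_eq]
      rw [h2, gradient_emdenFowler hy (hd0 _), smul_smul, ← rpow_mul_emdenFowler hy, emdenFowler]
    rw [← divergence_emdenFowler_smul hx (hZd _), divergence, divergence, h1.fderiv_eq]
  refine ⟨v, hEF, hvpos, hvC, fun t => ?_⟩
  have hx := hne t
  have hr : 0 < ‖Real.exp (-t) • e‖ := norm_pos_iff.2 hx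
  have ht : -Real.log ‖Real.exp (-t) • e‖ = t := by rw [hnorm, Real.log_exp, neg_neg]
  have heq := hu.equation _ hx
  rw [hbilap _ hx, hdiv _ hx, hu_eq _ hx] at heq
  simp only [emdenFowler, ht] at heq
  set r := ‖Real.exp (-t) • e‖ with hrdef
  have hpow : ∀ a : ℝ, r ^ a ≠ 0 := fun a => (Real.rpow_pos_of_pos hr a).ne'
  -- This is the critical relation between `β` and `p`: all terms then carry the same power of `r`,
  -- which cancels and leaves an autonomous equation.
  have hβ : β + -γ * p = -γ - α - 4 := by
    have hp1 : p + 1 ≠ 0 := by linarith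
    field_simp at hcrit
    rw [hγ]
    linarith
  have e1 : r ^ (-γ - 2 + -α - 2) = r ^ (-γ - α - 4) := by congr 1; ring
  have e2 : r ^ (-γ - 2 + (-α - 2)) = r ^ (-γ - α - 4) := by congr 1; ring
  have e3 : r ^ (-α - 4) * (r ^ (-γ) * v t) = r ^ (-γ - α - 4) * v t := by
    rw [← mul_assoc, ← Real.rpow_add hr]; congr 2; ring
  have e4 : r ^ β * (r ^ (-γ) * v t) ^ p = r ^ (-γ - α - 4) * v t ^ p := by
    rw [Real.mul_rpow (Real.rpow_nonneg hr.le _) (hvpos t).le, ← Real.rpow_mul hr.le, ← mul_assoc,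
      ← Real.rpow_add hr, hβ]
  rw [e1, e2, e4, mul_assoc μ, e3] at heq
  refine mul_left_cancel₀ (hpow (-γ - α - 4)) (Eq.trans ?_ heq)
  have hα : α = n - 4 - 2 * γ := by rw [hγ]; ring
  simp only [hW, hW₁, hW₂, hZ, hD, coeffK2, coeffK0, hα]
  ring

/-- The characteristic polynomial of the linear part has real roots, and both squares exceed
`((n - 4 - α) / 2)²`. -/
lemma exists_coeff_factorization {n : ℕ} {α lam μ : ℝ} (hμ : 0 < μ)
    (hlam : lam ≤ ((n : ℝ) - 2) * (α + 2) - 2 * √μ) :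
    ∃ A B : ℝ, (((n : ℝ) - 4 - α) / 2) ^ 2 < A ∧ A ≤ B ∧ coeffK2 n α lam = A + B ∧
      coeffK0 n α lam μ = A * B := by
  set γ : ℝ := ((n : ℝ) - 4 - α) / 2 with hγ
  -- Putting `X = γ² + Z` turns `X² - K₂ X + K₀` into `Z² - σ Z + μ`. The bound on `lam` says `σ ≥ 2
  -- √μ`, so the roots `Z` are real, and `μ > 0` makes both positive.
  set σ : ℝ := ((n : ℝ) - 2) * (α + 2) - lam with hσ
  have hs := Real.sqrt_nonneg μ
  have hs2 := Real.sq_sqrt hμ.le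
  have hs0 : 0 < √μ := Real.sqrt_pos.2 hμ
  have hσμ : 2 * √μ ≤ σ := by linarith
  have hK2 : coeffK2 n α lam = 2 * γ ^ 2 + σ := by rw [coeffK2, hσ, hγ]; ring
  have hK0 : coeffK0 n α lam μ = γ ^ 4 + γ ^ 2 * σ + μ := by rw [coeffK0, hσ, hγ]; ring
  have hdisc : 0 ≤ σ ^ 2 - 4 * μ := by nlinarith
  set d := √(σ ^ 2 - 4 * μ) with hd
  have hd0 : 0 ≤ d := Real.sqrt_nonneg _
  have hd2 : d ^ 2 = σ ^ 2 - 4 * μ := Real.sq_sqrt hdisc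
  have hdσ : d < σ := by nlinarith
  exact ⟨γ ^ 2 + (σ - d) / 2, γ ^ 2 + (σ + d) / 2, by linarith, by linarith, by rw [hK2]; ring,
    by rw [hK0]; linear_combination (1 / 4) * hd2⟩

/-- In terms of `t = -ln |x|` one has `u(x) = e^{γ t} v(t)`, and `x → 0` corresponds to `t → ∞`. -/
lemma hasRemovableSingularity_of_tendsto {n : ℕ} {α : ℝ} {u : EuclideanSpace ℝ (Fin n) → ℝ}
    {v : ℝ → ℝ} (h : IsEmdenFowlerTransform α u v)
    (hv : Tendsto (fun t => Real.exp (((n : ℝ) - 4 - α) / 2 * t) * v t) atTop (𝓝 0)) :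
    HasRemovableSingularity u := by
  refine ⟨0, ?_⟩
  have h1 : Tendsto (fun x : EuclideanSpace ℝ (Fin n) => ‖x‖) (𝓝[≠] 0) (𝓝[>] 0) :=
    tendsto_norm_nhdsNE_zero
  have h2 := hv.comp (tendsto_neg_atBot_atTop.comp (Real.tendsto_log_nhdsGT_zero.comp h1))
  refine h2.congr' ?_
  filter_upwards [self_mem_nhdsWithin] with x hx
  have hr : 0 < ‖x‖ := norm_pos_iff.2 hx
  simp only [Function.comp_apply]
  rw [h x hx, Real.rpow_def_of_pos hr, ← mul_assoc, ← Real.exp_add, mul_neg,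
    mul_comm (Real.log ‖x‖), neg_add_cancel, Real.exp_zero, one_mul]

theorem theorem1p3 (n : ℕ) (hn : 5 ≤ n) (α β p lam μ : ℝ)
    (hα : -2 < α) (hα' : α < (n : ℝ) - 4) (hp : 1 < p)
    (hcrit : ((n : ℝ) + α) / 2 + ((n : ℝ) + β) / (p + 1) = (n : ℝ) - 2)
    (hμ : 0 < μ) (hlam : lam ≤ ((n : ℝ) - 2) * (α + 2) - 2 * Real.sqrt μ) :
    (∀ u : EuclideanSpace ℝ (Fin n) → ℝ,
      IsPositiveRadialSolution α β p lam μ u → ¬ HasRemovableSingularity u →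
        ∃ v : ℝ → ℝ, IsEmdenFowlerTransform α u v ∧ IsPeriodic v) ∧
    (∀ a : ℝ, 0 < a → a < coeffK0 n α lam μ ^ (1 / (p - 1)) →
      ∃ v : ℝ → ℝ,
        (IsODESolution (coeffK2 n α lam) (coeffK0 n α lam μ) p v ∧ IsPeriodic v ∧
          IsLeast (Set.range v) a) ∧
        ∀ w : ℝ → ℝ,
          IsODESolution (coeffK2 n α lam) (coeffK0 n α lam μ) p w → IsPeriodic w →
            IsLeast (Set.range w) a → ∃ τ : ℝ, ∀ t, w t = v (t + τ)) := by
  obtain ⟨A, B, hγA, hAB, hK2, hK0⟩ := exists_coeff_factorization hμ hlam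
  constructor
  · intro u hu hsing
    obtain ⟨v, hEF, hpos, hode⟩ := hu.exists_isODESolution (by omega) hp hcrit
    refine ⟨v, hEF, ?_⟩
    exact ((hode.isTrajectory hK2 hK0).isPeriodic_or_tendsto_exp_mul_zero (by linarith) hγA hAB hp
      hpos).resolve_right fun hlim => hsing (hasRemovableSingularity_of_tendsto hEF hlim)
  · intro a ha ham
    have hA : 0 < A := (sq_nonneg _).trans_lt hγA
    rw [hK0] at ham
    rw [hK2, hK0]
    exact exists_unique_isPeriodic hA (hA.trans_le hAB) hp ha ham
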